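/- Let $0<\beta<\gamma<1$, $0\le\mu\le1$, $p>1/\beta$, $K\ge 0$ and $b\in\mathbb{R}$ ($b$ may be negative). Here $C_{1-\beta}(0,\infty)$ is the set of continuous $x:(0,\infty)\to\mathbb{R}$ for which $t^{1-\beta}x(t)$ extends continuously to $[0,\infty)$, and $L^p_{\mathrm{Loc}}[0,\infty)$ is the set of real functions that are $L^p$ on every bounded subinterval of $[0,\infty)$. For $x<0$, $x^\mu$ denotes any fixed real-valued convention with $|x^\mu|=|x|^\mu$ (for instance $|x|^\mu$ or $\operatorname{sgn}(x)|x|^\mu$), and $0^0=1$. Let $l,l_1,k,k_1:(0,\infty)\to\mathbb{R}$ be such that $t^{(1-\mu)(1-\beta)}l(t)$, $t^{(1-\mu)(1-\beta)}l_1(t)$, $t^{1-\beta}k(t)$ and $t^{1-\beta}k_1(t)$ belong to $C(0,\infty)\cap L^p_{\mathrm{Loc}}[0,\infty)$, such that $t^\gamma|l(t)|\le K$ and $t^\gamma|l_1(t)|\le K$ for all $t\in[1,\infty)$, and such that $$\lim_{t\to\infty}t^\beta k(t)=\lim_{t\to\infty}t^\beta k_1(t)=b.$$ Let $f:(0,\infty)\times\mathbb{R}\to\mathbb{R}$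 be continuous with $$l_1(t)x^\mu+k_1(t)\le f(t,x)\le l(t)x^\mu+k(t)\qquad\text{for all }(t,x)\in(0,\infty)\times\mathbb{R}.$$ Then for every $x_0\in\mathbb{R}$ the Riemann–Liouville problem $$D_{0^+}^{\beta}x(t)=f(t,x(t))\quad(t\in(0,\infty)),\qquad \lim_{t\to0^+}t^{1-\beta}x(t)=x_0,$$ where $$D_{0^+}^{\beta}x(t)=\frac{d}{dt}I_{0^+}^{1-\beta}x(t),\qquad I_{0^+}^{1-\beta}x(t)=\frac1{\Gamma(1-\beta)}\int_0^t\frac{x(s)}{(t-s)^{\beta}}\,ds,$$ and where being a solution includes that $x$ is integrable on $[0,T]$ and that $I_{0^+}^{1-\beta}x$ (extended to $t=0$ by its limit) is absolutely continuous on $[0,T]$ for every $T>0$, has at least one solution $x\in C_{1-\beta}(0,\infty)$ with $$\lim_{t\to\infty}x(t)=\frac{b\pi}{\Gamma(\beta)\sin(\beta\pi)}.$$ -/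

import Mathlib

open Real Set Filter Topology MeasureTheory

/-- The Riemann-Liouville fractional integral of order `α`,
`I^α ρ(t) = (1/Γ(α)) ∫₀ᵗ ρ(s) / (t-s)^(1-α) ds`. -/
noncomputable def rlIntegral (α : ℝ) (ρ : ℝ → ℝ) (t : ℝ) : ℝ :=
  1 / Real.Gamma α * ∫ s in (0 : ℝ)..t, ρ s / (t - s) ^ (1 - α)

/-- `D^β ρ = g` on `(0,∞)` in the Riemann-Liouville sense: `ρ` is integrable on every `[0,T]`,
`I^(1-β) ρ` is absolutely continuous on every `(0,T]`, i.e. it agrees there with an absolutely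
continuous function on `[0,T]` (the value at `0` is its limit there, which the integral formula
does not see), and `d/dt I^(1-β) ρ (t) = g t` for every `t > 0`. -/
structure HasRLDeriv (β : ℝ) (ρ g : ℝ → ℝ) : Prop where
  integrable : ∀ T : ℝ, 0 < T → IntervalIntegrable ρ volume 0 T
  absCont : ∀ T : ℝ, 0 < T → ∃ G : ℝ → ℝ, AbsolutelyContinuousOnInterval G 0 T ∧
    ∀ t ∈ Ioc 0 T, rlIntegral (1 - β) ρ t = G t
  hasDerivAt : ∀ t : ℝ, 0 < t → HasDerivAt (rlIntegral (1 - β) ρ) (g t) t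

/-- `x` solves `D^β x(t) = f(t, x(t))` for `t ∈ (0,∞)`, `lim_{t → 0+} t^(1-β) x(t) = x₀`. -/
structure IsRLSolution (β : ℝ) (f : ℝ → ℝ → ℝ) (x₀ : ℝ) (x : ℝ → ℝ) : Prop where
  equation : HasRLDeriv β x (fun t => f t (x t))
  initial : Tendsto (fun t => t ^ (1 - β) * x t) (𝓝[>] 0) (𝓝 x₀)

/-- The space `C_α(0,∞)`: `x` is continuous on `(0,∞)` and `t^α x(t)` extends continuously
to `[0,∞)`. -/
def MemCWeighted (α : ℝ) (x : ℝ → ℝ) : Prop :=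
  ContinuousOn x (Ioi 0) ∧ ∃ L : ℝ, Tendsto (fun t => t ^ α * x t) (𝓝[>] 0) (𝓝 L)

/-- The space `C(0,∞) ∩ L^p_loc[0,∞)`. -/
def MemCLpLoc (p : ℝ) (g : ℝ → ℝ) : Prop :=
  ContinuousOn g (Ioi 0) ∧
    ∀ T : ℝ, 0 < T → MemLp g (ENNReal.ofReal p) (volume.restrict (Icc 0 T))

/-- `P` is a real-valued version on all of `ℝ` of the power function `x ↦ x^μ`: it is the usual
power for `x ≥ 0`, and `|P x| = |x|^μ` for `x < 0`. This covers every convention for real powers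
of negative numbers, such as `|x|^μ` (as for `μ = 2/3`) and `sgn(x)|x|^μ` (as for `μ = 1/3` and
`μ = 1`). -/
def IsRealPower (μ : ℝ) (P : ℝ → ℝ) : Prop :=
  (∀ x : ℝ, 0 ≤ x → P x = x ^ μ) ∧ ∀ x : ℝ, x < 0 → |P x| = |x| ^ μ

/-!
In the unknown `y(t) = t^(1-β) x(t)` the problem is the Volterra equation
`y = x₀ + t^(1-β) I^β f(s, s^(β-1) y(s))`. Since `p > 1/β`, there is `a` with `1/p < a < β`, and by
Hölder's inequality the weight `φ` in `|f(s, s^(β-1) v)| ≤ φ(s) (1 + |v|)` satisfies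
`I^a φ(t) = O(t^(β-1))` near `0`. The spare order `β - a` makes the right-hand side equicontinuous
and gives an a priori bound in a norm weighted by `exp(-l t)`, so Tonelli's delayed approximations
have a limit point by Arzelà-Ascoli.

For large `s` one has `|f(s, x)| ≤ (η |x| + C) s^(-β)` with `η` as small as desired. As
`I^β s^(-β) = Γ(1-β)`, evaluating the equation at a running maximum of `|x|` shows that `x` is
bounded. Then the sandwich forces `t^β f(t, x(t)) → b`, hence `x(t) → b Γ(1-β)`.
-/

/-- The integral `∫₀ᵗ (t - s)^(α-1) F(s) ds` defining `I^α F(t)` converges absolutely; otherwise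
`rlIntegral α F t` has the junk value `0`. -/
def RLIntegrable (α : ℝ) (F : ℝ → ℝ) (t : ℝ) : Prop :=
  IntegrableOn (fun s => (t - s) ^ (α - 1) * F s) (Ioc 0 t)

lemma rlIntegral_eq_setIntegral (α : ℝ) (F : ℝ → ℝ) {t : ℝ} (ht : 0 ≤ t) :
    rlIntegral α F t = 1 / Real.Gamma α * ∫ s in Ioc 0 t, (t - s) ^ (α - 1) * F s := by
  rw [rlIntegral, intervalIntegral.integral_of_le ht]
  congr 1
  refine setIntegral_congr_fun measurableSet_Ioc fun s hs => ?_
  rw [← neg_sub 1 α, rpow_neg (sub_nonneg.2 hs.2), div_eq_inv_mul]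

lemma rlIntegral_one (F : ℝ → ℝ) (t : ℝ) : rlIntegral 1 F t = ∫ s in (0 : ℝ)..t, F s := by
  simp [rlIntegral]

lemma rlIntegrable_one {F : ℝ → ℝ} {t : ℝ} : RLIntegrable 1 F t ↔ IntegrableOn F (Ioc 0 t) := by
  simp [RLIntegrable]

lemma rlIntegral_congr {α t : ℝ} {F G : ℝ → ℝ} (ht : 0 ≤ t) (h : EqOn F G (Ioc 0 t)) :
    rlIntegral α F t = rlIntegral α G t := by
  rw [rlIntegral_eq_setIntegral α F ht, rlIntegral_eq_setIntegral α G ht]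
  congr 1
  exact setIntegral_congr_fun measurableSet_Ioc fun s hs => by simp only [h hs]

lemma RLIntegrable.const_mul {α t : ℝ} {F : ℝ → ℝ} (hF : RLIntegrable α F t) (c : ℝ) :
    RLIntegrable α (fun s => c * F s) t := by
  simpa only [RLIntegrable, IntegrableOn, mul_left_comm] using Integrable.const_mul hF c

lemma RLIntegrable.add {α t : ℝ} {F G : ℝ → ℝ} (hF : RLIntegrable α F t)
    (hG : RLIntegrable α G t) : RLIntegrable α (fun s => F s + G s) t := by
  simpa only [RLIntegrable, IntegrableOn, mul_add] using Integrable.fun_add hF hG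

lemma rlIntegral_const_mul (α c : ℝ) (F : ℝ → ℝ) (t : ℝ) :
    rlIntegral α (fun s => c * F s) t = c * rlIntegral α F t := by
  simp only [rlIntegral, mul_div_assoc, intervalIntegral.integral_const_mul]
  ring

lemma rlIntegral_add {α t : ℝ} {F G : ℝ → ℝ} (ht : 0 ≤ t) (hF : RLIntegrable α F t)
    (hG : RLIntegrable α G t) :
    rlIntegral α (fun s => F s + G s) t = rlIntegral α F t + rlIntegral α G t := by
  simp only [rlIntegral_eq_setIntegral _ _ ht, mul_add]
  rw [integral_add hF hG, mul_add]

lemma ae_restrict_Ioc_mem_Ioo (a b : ℝ) : ∀ᵐ s ∂volume.restrict (Ioc a b), s ∈ Ioo a b := by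
  rw [← restrict_Ioo_eq_restrict_Ioc]
  exact ae_restrict_mem measurableSet_Ioo

lemma RLIntegrable.aestronglyMeasurable {α t : ℝ} {F : ℝ → ℝ} (hF : RLIntegrable α F t) :
    AEStronglyMeasurable F (volume.restrict (Ioc 0 t)) := by
  have hmeas : Measurable fun s : ℝ => (t - s) ^ (1 - α) := by fun_prop
  refine (hmeas.aestronglyMeasurable.mul (Integrable.aestronglyMeasurable hF)).congr ?_
  filter_upwards [ae_restrict_Ioc_mem_Ioo 0 t] with s hs
  rw [Pi.mul_apply, ← mul_assoc, ← rpow_add (sub_pos.2 hs.2)]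
  simp

lemma RLIntegrable.mono {α α' t : ℝ} {F : ℝ → ℝ} (hα : α ≤ α') (hF : RLIntegrable α F t) :
    RLIntegrable α' F t := by
  have hmeas : Measurable fun s : ℝ => (t - s) ^ (α' - α) := by fun_prop
  have hbound : ∀ᵐ s ∂volume.restrict (Ioc 0 t), ‖(t - s) ^ (α' - α)‖ ≤ t ^ (α' - α) := by
    filter_upwards [ae_restrict_mem measurableSet_Ioc] with s hs
    rw [Real.norm_of_nonneg (rpow_nonneg (sub_nonneg.2 hs.2) _)]
    exact rpow_le_rpow (sub_nonneg.2 hs.2) (by linarith [hs.1]) (sub_nonneg.2 hα)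
  refine (Integrable.bdd_mul hF hmeas.aestronglyMeasurable hbound).congr ?_
  filter_upwards [ae_restrict_Ioc_mem_Ioo 0 t] with s hs
  rw [← mul_assoc, ← rpow_add (sub_pos.2 hs.2)]
  ring_nf

lemma RLIntegrable.integrableOn {α t : ℝ} {F : ℝ → ℝ} (hα : α ≤ 1) (hF : RLIntegrable α F t) :
    IntegrableOn F (Ioc 0 t) :=
  rlIntegrable_one.1 (hF.mono hα)

lemma betaIntegral_Ioc {u v t : ℝ} (hu : 0 < u) (hv : 0 < v) (ht : 0 < t) :
    ∫ s in Ioc 0 t, s ^ (u - 1) * (t - s) ^ (v - 1) =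
      Real.Gamma u * Real.Gamma v / Real.Gamma (u + v) * t ^ (u + v - 1) := by
  have hG : Real.Gamma (u + v) ≠ 0 := (Real.Gamma_pos_of_pos (add_pos hu hv)).ne'
  have hbeta : (Real.Gamma u * Real.Gamma v / Real.Gamma (u + v) : ℂ) =
      Complex.betaIntegral u v := by
    rw [div_eq_iff (by exact_mod_cast hG), ← Complex.Gamma_ofReal, ← Complex.Gamma_ofReal,
      ← Complex.Gamma_ofReal, Complex.Gamma_mul_Gamma_eq_betaIntegral (by simpa using hu)
        (by simpa using hv), Complex.ofReal_add, mul_comm]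
  rw [← intervalIntegral.integral_of_le ht.le]
  apply Complex.ofReal_injective
  rw [← intervalIntegral.integral_ofReal]
  push_cast [Complex.ofReal_cpow ht.le]
  rw [hbeta, mul_comm, ← Complex.betaIntegral_scaled u v ht]
  refine intervalIntegral.integral_congr fun s hs => ?_
  rw [uIcc_of_le ht.le] at hs
  simp only [Complex.ofReal_cpow hs.1, Complex.ofReal_cpow (sub_nonneg.2 hs.2),
    Complex.ofReal_sub, Complex.ofReal_one]

lemma integral_betaKernel {u v s t : ℝ} (hu : 0 < u) (hv : 0 < v) (hst : s < t) :
    ∫ r in Ioc s t, (t - r) ^ (u - 1) * (r - s) ^ (v - 1) =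
      Real.Gamma u * Real.Gamma v / Real.Gamma (u + v) * (t - s) ^ (u + v - 1) := by
  have h := intervalIntegral.integral_comp_sub_right (a := s) (b := t)
    (fun w => w ^ (v - 1) * ((t - s) - w) ^ (u - 1)) s
  rw [sub_self, intervalIntegral.integral_of_le hst.le,
    intervalIntegral.integral_of_le (sub_nonneg.2 hst.le),
    betaIntegral_Ioc hv hu (sub_pos.2 hst)] at h
  rw [add_comm u v, mul_comm (Real.Gamma u), ← h]
  refine setIntegral_congr_fun measurableSet_Ioc fun r _ => ?_
  simp only [sub_sub_sub_cancel_right, mul_comm]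

-- A non-integrable kernel would have integral `0`.
lemma integrableOn_betaKernel {u v s t : ℝ} (hu : 0 < u) (hv : 0 < v) (hst : s < t) :
    IntegrableOn (fun r => (t - r) ^ (u - 1) * (r - s) ^ (v - 1)) (Ioc s t) := by
  by_contra h
  have hpos : 0 < Real.Gamma u * Real.Gamma v / Real.Gamma (u + v) * (t - s) ^ (u + v - 1) := by
    have := Real.Gamma_pos_of_pos hu
    have := Real.Gamma_pos_of_pos hv
    have := Real.Gamma_pos_of_pos (add_pos hu hv)
    have := sub_pos.2 hst
    positivity
  exact hpos.ne (by rw [← integral_betaKernel hu hv hst, integral_undef h])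

lemma rlIntegrable_rpow {α r t : ℝ} (hα : 0 < α) (hr : -1 < r) (ht : 0 < t) :
    RLIntegrable α (fun s => s ^ r) t := by
  simpa [RLIntegrable] using integrableOn_betaKernel hα (by linarith : 0 < r + 1) ht

lemma rlIntegral_rpow {α r t : ℝ} (hα : 0 < α) (hr : -1 < r) (ht : 0 < t) :
    rlIntegral α (fun s => s ^ r) t =
      Real.Gamma (r + 1) / Real.Gamma (α + r + 1) * t ^ (α + r) := by
  have h := integral_betaKernel hα (by linarith : 0 < r + 1) ht
  simp only [sub_zero, add_sub_cancel_right, ← add_assoc] at h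
  rw [rlIntegral_eq_setIntegral _ _ ht.le, h]
  have := (Real.Gamma_pos_of_pos hα).ne'
  field_simp

/-! ### The semigroup law -/

/-- The kernel `(t - r)^(α-1) (r - s)^(β-1)` on `s < r` of the iterated integral `I^α I^β F(t)`. -/
noncomputable def semigroupKernel (α β t r s : ℝ) : ℝ :=
  (Ioi s).indicator (fun r => (t - r) ^ (α - 1) * (r - s) ^ (β - 1)) r

section Semigroup

variable {α β t : ℝ}

lemma measurable_semigroupKernel (α β t : ℝ) :
    Measurable (Function.uncurry (semigroupKernel α β t)) := by
  have h : Function.uncurry (semigroupKernel α β t) = {q : ℝ × ℝ | q.2 < q.1}.indicator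
      (fun q => (t - q.1) ^ (α - 1) * (q.1 - q.2) ^ (β - 1)) := by
    ext ⟨r, s⟩
    simp [semigroupKernel, Function.uncurry, indicator]
  rw [h]
  exact Measurable.indicator (by fun_prop) (measurableSet_lt measurable_snd measurable_fst)

lemma semigroupKernel_nonneg {r s : ℝ} (hrt : r ≤ t) : 0 ≤ semigroupKernel α β t r s :=
  indicator_apply_nonneg fun hsr => mul_nonneg (rpow_nonneg (sub_nonneg.2 hrt) _)
    (rpow_nonneg (sub_nonneg.2 (le_of_lt hsr)) _)

lemma integral_semigroupKernel (hα : 0 < α) (hβ : 0 < β) {s : ℝ} (hs : s ∈ Ioo 0 t) :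
    ∫ r in Ioc 0 t, semigroupKernel α β t r s =
      Real.Gamma α * Real.Gamma β / Real.Gamma (α + β) * (t - s) ^ (α + β - 1) := by
  simp only [semigroupKernel]
  rw [← integral_betaKernel hα hβ hs.2, setIntegral_indicator measurableSet_Ioi, Ioc_inter_Ioi,
    max_eq_right hs.1.le]

lemma integrableOn_semigroupKernel (hα : 0 < α) (hβ : 0 < β) {s : ℝ} (hs : s ∈ Ioo 0 t) :
    IntegrableOn (fun r => semigroupKernel α β t r s) (Ioc 0 t) := by
  simp only [semigroupKernel]
  rw [integrableOn_indicator_iff measurableSet_Ioi, inter_comm, Ioc_inter_Ioi,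
    max_eq_right hs.1.le]
  exact integrableOn_betaKernel hα hβ hs.2

lemma integral_semigroupKernel_mul (hβ : 0 < β) (F : ℝ → ℝ) {r : ℝ} (hr : r ∈ Ioc 0 t) :
    ∫ s in Ioc 0 t, semigroupKernel α β t r s * F s =
      (t - r) ^ (α - 1) * (Real.Gamma β * rlIntegral β F r) := by
  have hkernel : ∀ s, semigroupKernel α β t r s * F s =
      (Iio r).indicator (fun s => (t - r) ^ (α - 1) * ((r - s) ^ (β - 1) * F s)) s := by
    intro s
    by_cases h : s < r <;> simp [semigroupKernel, indicator, h, mul_assoc]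
  have hdomain : Ioc 0 t ∩ Iio r = Ioo 0 r := by
    ext s
    simp only [mem_inter_iff, mem_Ioc, mem_Iio, mem_Ioo]
    exact ⟨fun h => ⟨h.1.1, h.2⟩, fun h => ⟨⟨h.1, h.2.le.trans hr.2⟩, h.2⟩⟩
  simp only [hkernel]
  rw [setIntegral_indicator measurableSet_Iio, hdomain, integral_const_mul,
    ← integral_Ioc_eq_integral_Ioo, rlIntegral_eq_setIntegral _ _ hr.1.le, ← mul_assoc _ (1 / _),
    mul_one_div_cancel (Real.Gamma_pos_of_pos hβ).ne', one_mul]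

lemma integrable_semigroupKernel_mul {F : ℝ → ℝ} (hα : 0 < α) (hβ : 0 < β)
    (hF : RLIntegrable (α + β) F t) :
    Integrable (Function.uncurry fun r s => semigroupKernel α β t r s * F s)
      ((volume.restrict (Ioc 0 t)).prod (volume.restrict (Ioc 0 t))) := by
  have hmeas : AEStronglyMeasurable
      (Function.uncurry fun r s => semigroupKernel α β t r s * F s)
      ((volume.restrict (Ioc 0 t)).prod (volume.restrict (Ioc 0 t))) :=
    (measurable_semigroupKernel α β t).aestronglyMeasurable.mul hF.aestronglyMeasurable.comp_snd
  rw [integrable_prod_iff' hmeas]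
  constructor
  · filter_upwards [ae_restrict_Ioc_mem_Ioo 0 t] with s hs
      using (integrableOn_semigroupKernel hα hβ hs).mul_const (F s)
  · refine (hF.norm.const_mul (Real.Gamma α * Real.Gamma β / Real.Gamma (α + β))).congr ?_
    filter_upwards [ae_restrict_Ioc_mem_Ioo 0 t] with s hs
    simp only [Function.uncurry, norm_mul]
    rw [integral_mul_const, ← mul_assoc,
      Real.norm_of_nonneg (rpow_nonneg (sub_nonneg.2 hs.2.le) _),
      ← integral_semigroupKernel hα hβ hs]
    congr 1
    exact setIntegral_congr_fun measurableSet_Ioc fun r hr =>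
      (Real.norm_of_nonneg (semigroupKernel_nonneg hr.2)).symm

lemma rlIntegrable_rlIntegral {F : ℝ → ℝ} (hα : 0 < α) (hβ : 0 < β)
    (hF : RLIntegrable (α + β) F t) : RLIntegrable α (rlIntegral β F) t := by
  refine (((integrable_semigroupKernel_mul hα hβ hF).integral_prod_left).const_mul
    (1 / Real.Gamma β)).congr ?_
  filter_upwards [ae_restrict_mem measurableSet_Ioc] with r hr
  have := (Real.Gamma_pos_of_pos hβ).ne'
  simp only [Function.uncurry, integral_semigroupKernel_mul hβ F hr]
  field_simp

theorem rlIntegral_rlIntegral {F : ℝ → ℝ} (hα : 0 < α) (hβ : 0 < β) (ht : 0 ≤ t)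
    (hF : RLIntegrable (α + β) F t) :
    rlIntegral α (rlIntegral β F) t = rlIntegral (α + β) F t := by
  have hΓα := (Real.Gamma_pos_of_pos hα).ne'
  have hΓβ := (Real.Gamma_pos_of_pos hβ).ne'
  have hfubini := integral_integral_swap (integrable_semigroupKernel_mul hα hβ hF)
  have hleft : ∫ r in Ioc 0 t, ∫ s in Ioc 0 t, semigroupKernel α β t r s * F s =
      Real.Gamma β * ∫ r in Ioc 0 t, (t - r) ^ (α - 1) * rlIntegral β F r := by
    rw [← integral_const_mul]
    refine setIntegral_congr_fun measurableSet_Ioc fun r hr => ?_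
    simp only [integral_semigroupKernel_mul hβ F hr]
    ring
  have hright : ∫ s in Ioc 0 t, ∫ r in Ioc 0 t, semigroupKernel α β t r s * F s =
      Real.Gamma α * Real.Gamma β / Real.Gamma (α + β) *
        ∫ s in Ioc 0 t, (t - s) ^ (α + β - 1) * F s := by
    rw [← integral_const_mul]
    refine integral_congr_ae ?_
    filter_upwards [ae_restrict_Ioc_mem_Ioo 0 t] with s hs
    rw [integral_mul_const, integral_semigroupKernel hα hβ hs, mul_assoc]
  rw [hleft, hright, mul_comm (Real.Gamma α), mul_div_assoc, mul_assoc] at hfubini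
  rw [rlIntegral_eq_setIntegral _ _ ht, rlIntegral_eq_setIntegral _ _ ht,
    mul_left_cancel₀ hΓβ hfubini]
  field_simp

end Semigroup

lemma integrableOn_rlIntegral {β t : ℝ} {F : ℝ → ℝ} (hβ : 0 < β) (hF : IntegrableOn F (Ioc 0 t)) :
    IntegrableOn (rlIntegral β F) (Ioc 0 t) := by
  refine rlIntegrable_one.1 (rlIntegrable_rlIntegral one_pos hβ ?_)
  exact (rlIntegrable_one.2 hF).mono (by linarith)

lemma rlIntegral_one_sub_of_volterra {β x₀ t : ℝ} {x F : ℝ → ℝ} (hβ : 0 < β) (hβ1 : β < 1)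
    (ht : 0 < t) (hF : IntegrableOn F (Ioc 0 t))
    (hx : ∀ t, 0 < t → x t = x₀ * t ^ (β - 1) + rlIntegral β F t) :
    rlIntegral (1 - β) x t = x₀ * Real.Gamma β + ∫ s in (0 : ℝ)..t, F s := by
  have hF1 : RLIntegrable (1 - β + β) F t := by rwa [sub_add_cancel, rlIntegrable_one]
  have hβ' : 0 < 1 - β := sub_pos.2 hβ1
  have hpow : rlIntegral (1 - β) (fun s => s ^ (β - 1)) t = Real.Gamma β := by
    rw [rlIntegral_rpow hβ' (by linarith) ht]
    simp
  rw [rlIntegral_congr ht.le fun s hs => hx s hs.1, rlIntegral_add ht.le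
    ((rlIntegrable_rpow hβ' (by linarith) ht).const_mul x₀) (rlIntegrable_rlIntegral hβ' hβ hF1),
    rlIntegral_const_mul, hpow, rlIntegral_rlIntegral hβ' hβ ht.le hF1, sub_add_cancel,
    rlIntegral_one]

theorem hasRLDeriv_of_volterra {β x₀ : ℝ} {x F : ℝ → ℝ} (hβ : 0 < β) (hβ1 : β < 1)
    (hFc : ContinuousOn F (Ioi 0)) (hFi : ∀ T : ℝ, 0 < T → IntegrableOn F (Ioc 0 T))
    (hx : ∀ t, 0 < t → x t = x₀ * t ^ (β - 1) + rlIntegral β F t) :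
    HasRLDeriv β x F := by
  have hint : ∀ T : ℝ, 0 < T → IntervalIntegrable F volume 0 T := fun T hT =>
    (intervalIntegrable_iff_integrableOn_Ioc_of_le hT.le).2 (hFi T hT)
  have hprimitive : ∀ t, 0 < t →
      rlIntegral (1 - β) x t = x₀ * Real.Gamma β + ∫ s in (0 : ℝ)..t, F s :=
    fun t ht => rlIntegral_one_sub_of_volterra hβ hβ1 ht (hFi t ht) hx
  refine ⟨fun T hT => ?_, fun T hT => ⟨fun t => x₀ * Real.Gamma β + ∫ s in (0 : ℝ)..t, F s, ?_,
    fun t ht => hprimitive t ht.1⟩, fun t ht => ?_⟩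
  · have hpow : IntegrableOn (fun s : ℝ => s ^ (β - 1)) (Ioc 0 T) :=
      rlIntegrable_one.1 (rlIntegrable_rpow one_pos (by linarith) hT)
    exact (intervalIntegrable_iff_integrableOn_Ioc_of_le hT.le).2 <| IntegrableOn.congr_fun
      ((hpow.const_mul x₀).add (integrableOn_rlIntegral hβ (hFi T hT)))
      (fun s hs => (hx s hs.1).symm) measurableSet_Ioc
  · have hconst : AbsolutelyContinuousOnInterval (fun _ : ℝ => x₀ * Real.Gamma β) 0 T :=
      ((LipschitzWith.const (x₀ * Real.Gamma β)).lipschitzOnWith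
        (s := uIcc 0 T)).absolutelyContinuousOnInterval
    exact hconst.add ((hint T hT).absolutelyContinuousOnInterval_intervalIntegral left_mem_uIcc)
  · have hderiv : HasDerivAt (fun t => x₀ * Real.Gamma β + ∫ s in (0 : ℝ)..t, F s) (F t) t :=
      (intervalIntegral.integral_hasDerivAt_right (hint t ht)
        (hFc.stronglyMeasurableAtFilter isOpen_Ioi t ht)
        (hFc.continuousAt (Ioi_mem_nhds ht))).const_add _
    refine hderiv.congr_of_eventuallyEq ?_
    filter_upwards [Ioi_mem_nhds ht] with s hs using hprimitive s hs

/-! ### Fractional integrals of dominated functions -/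

section AbelEstimates

variable {a β t T C : ℝ} {φ F : ℝ → ℝ}

lemma RLIntegrable.of_abs_le (hφ : RLIntegrable a φ t)
    (hFm : AEStronglyMeasurable F (volume.restrict (Ioc 0 t)))
    (hF : ∀ s ∈ Ioc 0 t, |F s| ≤ φ s) : RLIntegrable a F t := by
  have hmeas : Measurable fun s : ℝ => (t - s) ^ (a - 1) := by fun_prop
  refine Integrable.mono' hφ (hmeas.aestronglyMeasurable.mul hFm) ?_
  filter_upwards [ae_restrict_mem measurableSet_Ioc] with s hs
  have hkernel : 0 ≤ (t - s) ^ (a - 1) := rpow_nonneg (sub_nonneg.2 hs.2) _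
  rw [norm_mul, Real.norm_of_nonneg hkernel]
  exact mul_le_mul_of_nonneg_left (hF s hs) hkernel

lemma abs_setIntegral_mul_le_rlIntegral {κ : ℝ → ℝ} {D : ℝ} (ha : 0 < a) (ht : 0 ≤ t)
    (hφ : RLIntegrable a φ t) (hκ : ∀ s ∈ Ioo 0 t, |κ s| ≤ D * (t - s) ^ (a - 1))
    (hF : ∀ s ∈ Ioo 0 t, |F s| ≤ φ s) :
    |∫ s in Ioc 0 t, κ s * F s| ≤ D * (Real.Gamma a * rlIntegral a φ t) := by
  have hΓ := (Real.Gamma_pos_of_pos ha).ne'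
  rw [rlIntegral_eq_setIntegral _ _ ht, ← mul_assoc (Real.Gamma a), mul_one_div_cancel hΓ,
    one_mul, ← integral_const_mul, ← Real.norm_eq_abs]
  refine norm_integral_le_of_norm_le (Integrable.const_mul hφ D) ?_
  filter_upwards [ae_restrict_Ioc_mem_Ioo 0 t] with s hs
  rw [norm_mul, ← mul_assoc]
  exact mul_le_mul (hκ s hs) (hF s hs) (abs_nonneg _) ((abs_nonneg _).trans (hκ s hs))

lemma abs_sub_rpow_le {s δ : ℝ} (haβ : a ≤ β) (hst : s < t) (hδ : t - s ≤ δ) :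
    |(t - s) ^ (β - 1)| ≤ δ ^ (β - a) * (t - s) ^ (a - 1) := by
  have h : 0 < t - s := sub_pos.2 hst
  rw [abs_of_nonneg (by positivity), ← sub_add_sub_cancel β a 1, rpow_add h]
  exact mul_le_mul_of_nonneg_right (rpow_le_rpow h.le hδ (sub_nonneg.2 haβ)) (by positivity)

lemma abs_rlIntegral_le (ha : 0 < a) (haβ : a ≤ β) (ht : 0 ≤ t) (hφ : RLIntegrable a φ t)
    (hF : ∀ s ∈ Ioc 0 t, |F s| ≤ φ s) :
    |rlIntegral β F t| ≤ Real.Gamma a / Real.Gamma β * t ^ (β - a) * rlIntegral a φ t := by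
  have hΓ := Real.Gamma_pos_of_pos (ha.trans_le haβ)
  have hint := abs_setIntegral_mul_le_rlIntegral ha ht hφ
    (fun s hs => abs_sub_rpow_le haβ hs.2 (by linarith [hs.1] : t - s ≤ t))
    (fun s hs => hF s (Ioo_subset_Ioc_self hs))
  rw [rlIntegral_eq_setIntegral β F ht, abs_mul, abs_of_pos (one_div_pos.2 hΓ)]
  exact (mul_le_mul_of_nonneg_left hint (one_div_pos.2 hΓ).le).trans_eq (by ring)

lemma exp_neg_le_rpow_neg {ε z : ℝ} (hε : 0 ≤ ε) (hε1 : ε ≤ 1) (hz : 0 < z) :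
    Real.exp (-z) ≤ z ^ (-ε) := by
  rw [Real.exp_neg, rpow_neg hz.le]
  refine inv_anti₀ (by positivity) ?_
  rcases le_total z 1 with h | h
  · exact (rpow_le_one hz.le h hε).trans (Real.one_le_exp hz.le)
  · calc z ^ ε ≤ z ^ (1 : ℝ) := rpow_le_rpow_of_exponent_le h hε1
      _ = z := rpow_one z
      _ ≤ Real.exp z := by linarith [Real.add_one_le_exp z]

/- The factor `l^(a-β)`, small for large `l`, gives a priori bounds in an exponentially weighted
supremum norm (Bielecki's trick). -/
lemma abs_rlIntegral_le_of_exp {l : ℝ} (ha : 0 < a) (haβ : a ≤ β) (hβ1 : β ≤ 1) (hl : 0 < l)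
    (ht : 0 ≤ t) (hφ : RLIntegrable a φ t)
    (hF : ∀ s ∈ Ioc 0 t, |F s| ≤ Real.exp (l * s) * φ s) :
    |rlIntegral β F t| ≤
      Real.Gamma a / Real.Gamma β * l ^ (a - β) * Real.exp (l * t) * rlIntegral a φ t := by
  have hΓ := Real.Gamma_pos_of_pos (ha.trans_le haβ)
  have hkernel : ∀ s ∈ Ioo 0 t, |(t - s) ^ (β - 1) * Real.exp (l * s)| ≤
      l ^ (a - β) * Real.exp (l * t) * (t - s) ^ (a - 1) := by
    intro s hs
    have hts : 0 < t - s := sub_pos.2 hs.2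
    have hexp := exp_neg_le_rpow_neg (sub_nonneg.2 haβ) (by linarith) (mul_pos hl hts)
    rw [neg_sub, mul_rpow hl.le hts.le] at hexp
    calc |(t - s) ^ (β - 1) * Real.exp (l * s)|
        = (t - s) ^ (β - 1) * Real.exp (l * t) * Real.exp (-(l * (t - s))) := by
          rw [abs_of_nonneg (by positivity), mul_assoc, ← Real.exp_add]
          ring_nf
      _ ≤ (t - s) ^ (β - 1) * Real.exp (l * t) * (l ^ (a - β) * (t - s) ^ (a - β)) := by gcongr
      _ = l ^ (a - β) * Real.exp (l * t) * ((t - s) ^ (β - 1) * (t - s) ^ (a - β)) := by ring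
      _ = l ^ (a - β) * Real.exp (l * t) * (t - s) ^ (a - 1) := by
          rw [← rpow_add hts, add_comm, sub_add_sub_cancel]
  have hint := abs_setIntegral_mul_le_rlIntegral (F := fun s => Real.exp (-(l * s)) * F s)
    ha ht hφ hkernel fun s hs => by
      rw [abs_mul, Real.abs_exp, Real.exp_neg, inv_mul_le_iff₀ (Real.exp_pos _)]
      exact hF s (Ioo_subset_Ioc_self hs)
  have hcancel : ∀ s, (t - s) ^ (β - 1) * Real.exp (l * s) * (Real.exp (-(l * s)) * F s) =
      (t - s) ^ (β - 1) * F s := fun s => by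
    rw [Real.exp_neg]
    field_simp
  simp only [hcancel] at hint
  rw [rlIntegral_eq_setIntegral β F ht, abs_mul, abs_of_pos (one_div_pos.2 hΓ)]
  exact (mul_le_mul_of_nonneg_left hint (one_div_pos.2 hΓ).le).trans_eq (by ring)

lemma one_sub_rpow_le_one_sub_rpow {ρ p q : ℝ} (hρ0 : 0 ≤ ρ) (hρ1 : ρ ≤ 1) (hp0 : 0 ≤ p)
    (hp1 : p ≤ 1) (hq0 : 0 ≤ q) (hq1 : q ≤ 1) : 1 - ρ ^ p ≤ (1 - ρ) ^ q := by
  have hρ : ρ ^ (1 : ℝ) ≤ ρ ^ p := rpow_le_rpow_of_exponent_ge' hρ0 hρ1 hp0 hp1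
  have hρ' : (1 - ρ) ^ (1 : ℝ) ≤ (1 - ρ) ^ q :=
    rpow_le_rpow_of_exponent_ge' (sub_nonneg.2 hρ1) (by linarith) hq0 hq1
  rw [rpow_one] at hρ hρ'
  linarith

lemma abs_rpow_sub_one_sub_rpow_sub_one_le {u v : ℝ} (ha : 0 ≤ a) (haβ : a ≤ β) (hβ1 : β ≤ 1)
    (hu : 0 < u) (huv : u ≤ v) :
    |v ^ (β - 1) - u ^ (β - 1)| ≤ (v - u) ^ (β - a) * u ^ (a - 1) := by
  have hv : 0 < v := hu.trans_le huv
  have hdecr : v ^ (β - 1) ≤ u ^ (β - 1) := rpow_le_rpow_of_nonpos hu huv (by linarith)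
  have hv_eq : v ^ (β - 1) = u ^ (β - 1) * (u / v) ^ (1 - β) := by
    rw [div_rpow hu.le hv.le, ← neg_sub 1 β, rpow_neg hu.le, rpow_neg hv.le]
    field_simp
  have hratio : 1 - u / v ≤ (v - u) / u := by
    rw [one_sub_div hv.ne']
    exact div_le_div_of_nonneg_left (sub_nonneg.2 huv) hu huv
  have hratio0 : 0 ≤ 1 - u / v := sub_nonneg.2 ((div_le_one hv).2 huv)
  calc |v ^ (β - 1) - u ^ (β - 1)|
      = u ^ (β - 1) * (1 - (u / v) ^ (1 - β)) := by
        rw [abs_of_nonpos (sub_nonpos.2 hdecr), hv_eq]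
        ring
    _ ≤ u ^ (β - 1) * (1 - u / v) ^ (β - a) := by
        refine mul_le_mul_of_nonneg_left ?_ (by positivity)
        exact one_sub_rpow_le_one_sub_rpow (by positivity) (by linarith) (by linarith)
          (by linarith) (by linarith) (by linarith)
    _ ≤ u ^ (β - 1) * ((v - u) / u) ^ (β - a) := by gcongr
    _ = (v - u) ^ (β - a) * u ^ (a - 1) := by
        rw [div_rpow (sub_nonneg.2 huv) hu.le, div_eq_mul_inv, ← rpow_neg hu.le, mul_left_comm,
          ← rpow_add hu]
        ring_nf

lemma rlIntegral_sub_eq {t₁ t₂ : ℝ} (h1 : 0 ≤ t₁) (h12 : t₁ ≤ t₂) (hF₁ : RLIntegrable β F t₁)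
    (hF₂ : RLIntegrable β F t₂) :
    rlIntegral β F t₂ - rlIntegral β F t₁ = 1 / Real.Gamma β *
      ((∫ s in Ioc 0 t₁, ((t₂ - s) ^ (β - 1) - (t₁ - s) ^ (β - 1)) * F s) +
        ∫ s in Ioc 0 t₂, (Ioc t₁ t₂).indicator (fun s => (t₂ - s) ^ (β - 1)) s * F s) := by
  have hF₂' : IntegrableOn (fun s => (t₂ - s) ^ (β - 1) * F s) (Ioc 0 t₁) :=
    IntegrableOn.mono_set hF₂ (Ioc_subset_Ioc_right h12)
  have hsplit : ∫ s in Ioc 0 t₂, (t₂ - s) ^ (β - 1) * F s =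
      (∫ s in Ioc 0 t₁, (t₂ - s) ^ (β - 1) * F s) +
        ∫ s in Ioc t₁ t₂, (t₂ - s) ^ (β - 1) * F s := by
    rw [← Ioc_union_Ioc_eq_Ioc h1 h12]
    exact setIntegral_union (Ioc_disjoint_Ioc_of_le le_rfl) measurableSet_Ioc hF₂'
      (IntegrableOn.mono_set hF₂ (Ioc_subset_Ioc_left h1))
  have hindicator :
      ∫ s in Ioc 0 t₂, (Ioc t₁ t₂).indicator (fun s => (t₂ - s) ^ (β - 1)) s * F s =
        ∫ s in Ioc t₁ t₂, (t₂ - s) ^ (β - 1) * F s := by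
    simp only [← indicator_mul_left]
    rw [setIntegral_indicator measurableSet_Ioc, inter_eq_right.2 (Ioc_subset_Ioc_left h1)]
  simp only [sub_mul]
  rw [rlIntegral_eq_setIntegral _ _ h1, rlIntegral_eq_setIntegral _ _ (h1.trans h12), hsplit,
    hindicator, integral_sub hF₂' hF₁]
  ring

lemma abs_rlIntegral_sub_le {t₁ t₂ : ℝ} (ha : 0 < a) (haβ : a ≤ β) (hβ1 : β ≤ 1)
    (h1 : 0 ≤ t₁) (h12 : t₁ ≤ t₂) (hφ₁ : RLIntegrable a φ t₁) (hφ₂ : RLIntegrable a φ t₂)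
    (hFm : AEStronglyMeasurable F (volume.restrict (Ioc 0 t₂)))
    (hF : ∀ s ∈ Ioc 0 t₂, |F s| ≤ φ s) :
    |rlIntegral β F t₂ - rlIntegral β F t₁| ≤ Real.Gamma a / Real.Gamma β *
      (t₂ - t₁) ^ (β - a) * (rlIntegral a φ t₁ + rlIntegral a φ t₂) := by
  have hΓ := Real.Gamma_pos_of_pos (ha.trans_le haβ)
  have hsub : Ioc 0 t₁ ⊆ Ioc 0 t₂ := Ioc_subset_Ioc_right h12
  have hF₁ : RLIntegrable β F t₁ := (hφ₁.of_abs_le (hFm.mono_measure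
    (Measure.restrict_mono hsub le_rfl)) fun s hs => hF s (hsub hs)).mono haβ
  have hleft : |∫ s in Ioc 0 t₁, ((t₂ - s) ^ (β - 1) - (t₁ - s) ^ (β - 1)) * F s| ≤
      (t₂ - t₁) ^ (β - a) * (Real.Gamma a * rlIntegral a φ t₁) :=
    abs_setIntegral_mul_le_rlIntegral ha h1 hφ₁ (fun s hs => by
      simpa using abs_rpow_sub_one_sub_rpow_sub_one_le ha.le haβ hβ1 (sub_pos.2 hs.2)
        (sub_le_sub_right h12 s)) fun s hs => hF s (hsub (Ioo_subset_Ioc_self hs))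
  have hright :
      |∫ s in Ioc 0 t₂, (Ioc t₁ t₂).indicator (fun s => (t₂ - s) ^ (β - 1)) s * F s| ≤
        (t₂ - t₁) ^ (β - a) * (Real.Gamma a * rlIntegral a φ t₂) := by
    refine abs_setIntegral_mul_le_rlIntegral ha (h1.trans h12) hφ₂ (fun s hs => ?_)
      fun s hs => hF s (Ioo_subset_Ioc_self hs)
    by_cases h : s ∈ Ioc t₁ t₂
    · rw [indicator_of_mem h]
      exact abs_sub_rpow_le haβ hs.2 (sub_le_sub_left h.1.le _)
    · rw [indicator_of_notMem h, abs_zero]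
      exact mul_nonneg (rpow_nonneg (sub_nonneg.2 h12) _) (rpow_nonneg (sub_nonneg.2 hs.2.le) _)
  rw [rlIntegral_sub_eq h1 h12 hF₁ ((hφ₂.of_abs_le hFm hF).mono haβ), abs_mul,
    abs_of_pos (one_div_pos.2 hΓ)]
  exact (mul_le_mul_of_nonneg_left ((abs_add_le _ _).trans (add_le_add hleft hright))
    (one_div_pos.2 hΓ).le).trans_eq (by ring)

end AbelEstimates

/-- `φ` has absolutely convergent fractional integrals of order `a` on `(0, T]`, bounded by
`C t^(β-1)`: for functions dominated by `φ`, this controls `t^(1-β) I^β` near `0`. -/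
structure AbelBound (a β T C : ℝ) (φ : ℝ → ℝ) : Prop where
  nonneg : 0 ≤ C
  rlIntegrable : ∀ t ∈ Ioc 0 T, RLIntegrable a φ t
  rlIntegral_le : ∀ t ∈ Ioc 0 T, rlIntegral a φ t ≤ C * t ^ (β - 1)

lemma AbelBound.const_mul {a β T C M : ℝ} {φ : ℝ → ℝ} (hφ : AbelBound a β T C φ) (hM : 0 ≤ M) :
    AbelBound a β T (M * C) (fun s => M * φ s) where
  nonneg := mul_nonneg hM hφ.nonneg
  rlIntegrable t ht := (hφ.rlIntegrable t ht).const_mul M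
  rlIntegral_le t ht := by
    rw [rlIntegral_const_mul, mul_assoc]
    exact mul_le_mul_of_nonneg_left (hφ.rlIntegral_le t ht) hM

lemma AbelBound.add {a β T C D : ℝ} {φ ψ : ℝ → ℝ} (hφ : AbelBound a β T C φ)
    (hψ : AbelBound a β T D ψ) : AbelBound a β T (C + D) (fun s => φ s + ψ s) where
  nonneg := add_nonneg hφ.nonneg hψ.nonneg
  rlIntegrable t ht := (hφ.rlIntegrable t ht).add (hψ.rlIntegrable t ht)
  rlIntegral_le t ht := by
    rw [rlIntegral_add ht.1.le (hφ.rlIntegrable t ht) (hψ.rlIntegrable t ht), add_mul]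
    exact add_le_add (hφ.rlIntegral_le t ht) (hψ.rlIntegral_le t ht)

/-- The function `t^(1-β) I^β F(t)` on `(0,∞)`, extended by `0` to the rest of the line. -/
noncomputable def weightedRLIntegral (β : ℝ) (F : ℝ → ℝ) (t : ℝ) : ℝ :=
  max t 0 ^ (1 - β) * rlIntegral β F (max t 0)

lemma weightedRLIntegral_of_nonneg (β : ℝ) (F : ℝ → ℝ) {t : ℝ} (ht : 0 ≤ t) :
    weightedRLIntegral β F t = t ^ (1 - β) * rlIntegral β F t := by
  rw [weightedRLIntegral, max_eq_left ht]

lemma weightedRLIntegral_of_nonpos (β : ℝ) (F : ℝ → ℝ) {t : ℝ} (ht : t ≤ 0) :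
    weightedRLIntegral β F t = 0 := by
  simp [weightedRLIntegral, max_eq_right ht, rlIntegral]

section WeightedHolder

variable {a β T C : ℝ} {φ F : ℝ → ℝ}

lemma rpow_one_sub_mul_rpow_sub_one {t : ℝ} (β : ℝ) (ht : 0 < t) :
    t ^ (1 - β) * t ^ (β - 1) = 1 := by
  rw [← rpow_add ht, sub_add_sub_cancel, sub_self, rpow_zero]

lemma AbelBound.weighted_abs_rlIntegral_le (ha : 0 < a) (haβ : a ≤ β) (hφ : AbelBound a β T C φ)
    (hF : ∀ s ∈ Ioc 0 T, |F s| ≤ φ s) {t : ℝ} (ht : t ∈ Ioc 0 T) :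
    t ^ (1 - β) * |rlIntegral β F t| ≤ Real.Gamma a / Real.Gamma β * C * t ^ (β - a) := by
  have hΓ : 0 ≤ Real.Gamma a / Real.Gamma β :=
    (div_pos (Real.Gamma_pos_of_pos ha) (Real.Gamma_pos_of_pos (ha.trans_le haβ))).le
  have ht0 : 0 < t := ht.1
  have hbound := (abs_rlIntegral_le ha haβ ht.1.le (hφ.rlIntegrable t ht)
    fun s hs => hF s ⟨hs.1, hs.2.trans ht.2⟩).trans
      (mul_le_mul_of_nonneg_left (hφ.rlIntegral_le t ht) (by positivity))
  calc t ^ (1 - β) * |rlIntegral β F t|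
      ≤ t ^ (1 - β) * (Real.Gamma a / Real.Gamma β * t ^ (β - a) * (C * t ^ (β - 1))) := by
        gcongr
    _ = Real.Gamma a / Real.Gamma β * C * t ^ (β - a) := by
        linear_combination (Real.Gamma a / Real.Gamma β * C * t ^ (β - a)) *
          rpow_one_sub_mul_rpow_sub_one β ht.1

lemma AbelBound.weighted_abs_rlIntegral_sub_le (ha : 0 < a) (haβ : a ≤ β) (hβ1 : β ≤ 1)
    (hφ : AbelBound a β T C φ) (hFm : AEStronglyMeasurable F (volume.restrict (Ioc 0 T)))
    (hF : ∀ s ∈ Ioc 0 T, |F s| ≤ φ s) {t₁ t₂ : ℝ} (h1 : 0 < t₁) (h12 : t₁ ≤ t₂) (h2 : t₂ ≤ T) :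
    t₁ ^ (1 - β) * |rlIntegral β F t₂ - rlIntegral β F t₁| ≤
      2 * (Real.Gamma a / Real.Gamma β * C) * (t₂ - t₁) ^ (β - a) := by
  have hΓ : 0 ≤ Real.Gamma a / Real.Gamma β :=
    (div_pos (Real.Gamma_pos_of_pos ha) (Real.Gamma_pos_of_pos (ha.trans_le haβ))).le
  have hδ : 0 ≤ (t₂ - t₁) ^ (β - a) := rpow_nonneg (sub_nonneg.2 h12) _
  have ht₁ : t₁ ∈ Ioc 0 T := ⟨h1, h12.trans h2⟩
  have ht₂ : t₂ ∈ Ioc 0 T := ⟨h1.trans_le h12, h2⟩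
  have hsub : Ioc 0 t₂ ⊆ Ioc 0 T := Ioc_subset_Ioc_right h2
  have hφ₂ : rlIntegral a φ t₂ ≤ C * t₁ ^ (β - 1) := (hφ.rlIntegral_le t₂ ht₂).trans
    (mul_le_mul_of_nonneg_left (rpow_le_rpow_of_nonpos h1 h12 (sub_nonpos.2 hβ1)) hφ.nonneg)
  have hbound := (abs_rlIntegral_sub_le ha haβ hβ1 h1.le h12 (hφ.rlIntegrable t₁ ht₁)
    (hφ.rlIntegrable t₂ ht₂) (hFm.mono_measure (Measure.restrict_mono hsub le_rfl))
    fun s hs => hF s (hsub hs)).trans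
      (mul_le_mul_of_nonneg_left (add_le_add (hφ.rlIntegral_le t₁ ht₁) hφ₂) (mul_nonneg hΓ hδ))
  calc t₁ ^ (1 - β) * |rlIntegral β F t₂ - rlIntegral β F t₁|
      ≤ t₁ ^ (1 - β) * (Real.Gamma a / Real.Gamma β * (t₂ - t₁) ^ (β - a) *
          (C * t₁ ^ (β - 1) + C * t₁ ^ (β - 1))) := by gcongr
    _ = 2 * (Real.Gamma a / Real.Gamma β * C) * (t₂ - t₁) ^ (β - a) := by
        linear_combination 2 * (Real.Gamma a / Real.Gamma β * C) * (t₂ - t₁) ^ (β - a) *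
          rpow_one_sub_mul_rpow_sub_one β h1

lemma AbelBound.weight_sub_mul_abs_rlIntegral_le (ha : 0 < a) (haβ : a ≤ β) (hβ1 : β ≤ 1)
    (hφ : AbelBound a β T C φ) (hF : ∀ s ∈ Ioc 0 T, |F s| ≤ φ s) {t₁ t₂ : ℝ} (h1 : 0 ≤ t₁)
    (h12 : t₁ ≤ t₂) (ht₂ : t₂ ∈ Ioc 0 T) :
    (t₂ ^ (1 - β) - t₁ ^ (1 - β)) * |rlIntegral β F t₂| ≤
      Real.Gamma a / Real.Gamma β * C * (t₂ - t₁) ^ (β - a) := by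
  have h2 : 0 < t₂ := ht₂.1
  have hratio := one_sub_rpow_le_one_sub_rpow (p := 1 - β) (q := β - a) (div_nonneg h1 h2.le)
    ((div_le_one h2).2 h12) (by linarith) (by linarith) (by linarith) (by linarith)
  have hratio0 : 0 ≤ 1 - t₁ / t₂ := sub_nonneg.2 ((div_le_one h2).2 h12)
  calc (t₂ ^ (1 - β) - t₁ ^ (1 - β)) * |rlIntegral β F t₂|
      = (1 - (t₁ / t₂) ^ (1 - β)) * (t₂ ^ (1 - β) * |rlIntegral β F t₂|) := by
        rw [div_rpow h1 h2.le]
        field_simp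
    _ ≤ (1 - t₁ / t₂) ^ (β - a) * (Real.Gamma a / Real.Gamma β * C * t₂ ^ (β - a)) :=
        mul_le_mul hratio (hφ.weighted_abs_rlIntegral_le ha haβ hF ht₂) (by positivity)
          (by positivity)
    _ = Real.Gamma a / Real.Gamma β * C * (t₂ - t₁) ^ (β - a) := by
        rw [one_sub_div h2.ne', div_rpow (sub_nonneg.2 h12) h2.le]
        field_simp

lemma AbelBound.weightedRLIntegral_sub_le (ha : 0 < a) (haβ : a < β) (hβ1 : β < 1)
    (hφ : AbelBound a β T C φ) (hFm : AEStronglyMeasurable F (volume.restrict (Ioc 0 T)))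
    (hF : ∀ s ∈ Ioc 0 T, |F s| ≤ φ s) {t₁ t₂ : ℝ} (h1 : 0 ≤ t₁) (h12 : t₁ ≤ t₂) (h2 : t₂ ≤ T) :
    |weightedRLIntegral β F t₂ - weightedRLIntegral β F t₁| ≤
      3 * (Real.Gamma a / Real.Gamma β * C) * (t₂ - t₁) ^ (β - a) := by
  rcases h12.eq_or_lt with rfl | hlt
  · simp [zero_rpow (sub_pos.2 haβ).ne']
  have ht₂ : t₂ ∈ Ioc 0 T := ⟨h1.trans_lt hlt, h2⟩
  have hdiff : t₁ ^ (1 - β) * |rlIntegral β F t₂ - rlIntegral β F t₁| ≤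
      2 * (Real.Gamma a / Real.Gamma β * C) * (t₂ - t₁) ^ (β - a) := by
    rcases h1.eq_or_lt with rfl | h1
    · have hK : 0 ≤ Real.Gamma a / Real.Gamma β * C :=
        mul_nonneg (div_pos (Real.Gamma_pos_of_pos ha)
          (Real.Gamma_pos_of_pos (ha.trans haβ))).le hφ.nonneg
      rw [zero_rpow (sub_pos.2 hβ1).ne', zero_mul]
      positivity
    · exact hφ.weighted_abs_rlIntegral_sub_le ha haβ.le hβ1.le hFm hF h1 h12 h2
  have hweight : 0 ≤ t₂ ^ (1 - β) - t₁ ^ (1 - β) :=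
    sub_nonneg.2 (rpow_le_rpow h1 h12 (sub_pos.2 hβ1).le)
  rw [weightedRLIntegral_of_nonneg _ _ h1, weightedRLIntegral_of_nonneg _ _ (h1.trans h12)]
  calc |t₂ ^ (1 - β) * rlIntegral β F t₂ - t₁ ^ (1 - β) * rlIntegral β F t₁|
      = |t₁ ^ (1 - β) * (rlIntegral β F t₂ - rlIntegral β F t₁) +
          (t₂ ^ (1 - β) - t₁ ^ (1 - β)) * rlIntegral β F t₂| := by ring_nf
    _ ≤ t₁ ^ (1 - β) * |rlIntegral β F t₂ - rlIntegral β F t₁| +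
          (t₂ ^ (1 - β) - t₁ ^ (1 - β)) * |rlIntegral β F t₂| := by
        refine (abs_add_le _ _).trans_eq ?_
        rw [abs_mul, abs_mul, abs_of_nonneg (rpow_nonneg h1 _), abs_of_nonneg hweight]
    _ ≤ 3 * (Real.Gamma a / Real.Gamma β * C) * (t₂ - t₁) ^ (β - a) := by
        linarith [hφ.weight_sub_mul_abs_rlIntegral_le ha haβ.le hβ1.le hF h1 h12 ht₂]

end WeightedHolder

/-- The family `F` is dominated, on each `(0, T]`, by one function with an `AbelBound`; this is
what makes the fractional integrals `I^β (F i)` equicontinuous. -/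
def AbelDominated {ι : Type*} (a β : ℝ) (F : ι → ℝ → ℝ) : Prop :=
  ∀ T : ℝ, 0 < T → ∃ φ : ℝ → ℝ, (∃ C, AbelBound a β T C φ) ∧
    ∀ i, AEStronglyMeasurable (F i) (volume.restrict (Ioc 0 T)) ∧ ∀ s ∈ Ioc 0 T, |F i s| ≤ φ s

namespace AbelDominated

variable {ι : Type*} {a β : ℝ} {F : ι → ℝ → ℝ}

lemma rlIntegrable (haβ : a ≤ β) (hF : AbelDominated a β F) (i : ι) {t : ℝ} (ht : 0 < t) :
    RLIntegrable β (F i) t := by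
  obtain ⟨φ, ⟨C, hφ⟩, hFφ⟩ := hF t ht
  exact ((hφ.rlIntegrable t ⟨ht, le_rfl⟩).of_abs_le (hFφ i).1 (hFφ i).2).mono haβ

lemma exists_holder_modulus (ha : 0 < a) (haβ : a < β) (hβ1 : β < 1) (hF : AbelDominated a β F)
    {T : ℝ} (hT : 0 < T) : ∃ K, 0 ≤ K ∧ ∀ i, ∀ t₁ ≤ T, ∀ t₂ ≤ T,
      |weightedRLIntegral β (F i) t₁ - weightedRLIntegral β (F i) t₂| ≤
        K * |t₁ - t₂| ^ (β - a) := by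
  obtain ⟨φ, ⟨C, hφ⟩, hFφ⟩ := hF T hT
  have hK : 0 ≤ 3 * (Real.Gamma a / Real.Gamma β * C) := mul_nonneg zero_le_three
    (mul_nonneg (div_pos (Real.Gamma_pos_of_pos ha) (Real.Gamma_pos_of_pos (ha.trans haβ))).le
      hφ.nonneg)
  refine ⟨_, hK, fun i => ?_⟩
  have hle : ∀ t₁ t₂, t₁ ≤ t₂ → t₂ ≤ T →
      |weightedRLIntegral β (F i) t₂ - weightedRLIntegral β (F i) t₁| ≤
        3 * (Real.Gamma a / Real.Gamma β * C) * (t₂ - t₁) ^ (β - a) := by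
    intro t₁ t₂ h12 h2
    have hmax : max t₁ 0 ≤ max t₂ 0 := max_le_max_right 0 h12
    have hext : ∀ t, weightedRLIntegral β (F i) t = weightedRLIntegral β (F i) (max t 0) :=
      fun t => by simp only [weightedRLIntegral, max_assoc, max_self]
    have hlip : max t₂ 0 - max t₁ 0 ≤ t₂ - t₁ := by
      have := abs_max_sub_max_le_abs t₂ t₁ 0
      rwa [abs_of_nonneg (sub_nonneg.2 hmax), abs_of_nonneg (sub_nonneg.2 h12)] at this
    rw [hext t₁, hext t₂]
    exact (hφ.weightedRLIntegral_sub_le ha haβ hβ1 (hFφ i).1 (hFφ i).2 (le_max_right _ _) hmax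
      (max_le h2 hT.le)).trans (mul_le_mul_of_nonneg_left
        (rpow_le_rpow (sub_nonneg.2 hmax) hlip (sub_pos.2 haβ).le) hK)
  intro t₁ h1 t₂ h2
  rcases le_total t₁ t₂ with h | h
  · rw [abs_sub_comm, abs_sub_comm t₁, abs_of_nonneg (sub_nonneg.2 h)]
    exact hle t₁ t₂ h h2
  · rw [abs_of_nonneg (sub_nonneg.2 h)]
    exact hle t₂ t₁ h h1

lemma equicontinuous (ha : 0 < a) (haβ : a < β) (hβ1 : β < 1) (hF : AbelDominated a β F) :
    Equicontinuous fun i => weightedRLIntegral β (F i) := by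
  intro t₀
  obtain ⟨K, -, hK⟩ := hF.exists_holder_modulus ha haβ hβ1 (by positivity : 0 < |t₀| + 1)
  refine Metric.equicontinuousAt_of_continuity_modulus (fun t => K * |t₀ - t| ^ (β - a)) ?_ _ ?_
  · have hcont : Continuous fun t : ℝ => K * |t₀ - t| ^ (β - a) :=
      continuous_const.mul (Continuous.rpow_const (by fun_prop) fun _ => Or.inr (by linarith))
    simpa [zero_rpow (sub_pos.2 haβ).ne'] using hcont.tendsto t₀
  · have ht₀ : t₀ < |t₀| + 1 := by linarith [le_abs_self t₀]
    filter_upwards [Iio_mem_nhds ht₀] with t ht i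
    exact hK i t₀ ht₀.le t (le_of_lt ht)

lemma continuous (ha : 0 < a) (haβ : a < β) (hβ1 : β < 1) (hF : AbelDominated a β F) (i : ι) :
    Continuous (weightedRLIntegral β (F i)) :=
  (hF.equicontinuous ha haβ hβ1).continuous i

lemma tendsto_rlIntegral {F : ℕ → ℝ → ℝ} {G : ℝ → ℝ} (haβ : a ≤ β) (hF : AbelDominated a β F)
    {t : ℝ} (ht : 0 < t) (hlim : ∀ s ∈ Ioc 0 t, Tendsto (fun n => F n s) atTop (𝓝 (G s))) :
    Tendsto (fun n => rlIntegral β (F n) t) atTop (𝓝 (rlIntegral β G t)) := by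
  obtain ⟨φ, ⟨C, hφ⟩, hFφ⟩ := hF t ht
  simp only [rlIntegral_eq_setIntegral _ _ ht.le]
  refine Tendsto.const_mul _ (tendsto_integral_of_dominated_convergence _
    (fun n => Integrable.aestronglyMeasurable (hF.rlIntegrable haβ n ht))
    ((hφ.rlIntegrable t ⟨ht, le_rfl⟩).mono haβ) (fun n => ?_) ?_)
  · filter_upwards [ae_restrict_mem measurableSet_Ioc] with s hs
    have hkernel : 0 ≤ (t - s) ^ (β - 1) := rpow_nonneg (sub_nonneg.2 hs.2) _
    rw [norm_mul, Real.norm_of_nonneg hkernel]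
    exact mul_le_mul_of_nonneg_left ((hFφ n).2 s hs) hkernel
  · filter_upwards [ae_restrict_mem measurableSet_Ioc] with s hs
    exact (hlim s hs).const_mul _

end AbelDominated

lemma rpow_sub_one_le_of_half_le {β r t : ℝ} (hβ0 : 0 ≤ β) (hβ1 : β ≤ 1) (ht : 0 < t)
    (hr : t / 2 ≤ r) : r ^ (β - 1) ≤ 2 * t ^ (β - 1) := by
  have htwo : (2 : ℝ) ^ (1 - β) ≤ 2 := by
    simpa using rpow_le_rpow_of_exponent_le one_le_two (by linarith : 1 - β ≤ 1)
  calc r ^ (β - 1) ≤ (t / 2) ^ (β - 1) :=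
        rpow_le_rpow_of_nonpos (by positivity) hr (sub_nonpos.2 hβ1)
    _ = 2 ^ (1 - β) * t ^ (β - 1) := by
        rw [div_rpow ht.le zero_le_two, div_eq_inv_mul, ← rpow_neg zero_le_two, neg_sub]
    _ ≤ 2 * t ^ (β - 1) := by gcongr

lemma sub_rpow_mul_rpow_le {a β s t : ℝ} (haβ : a ≤ β) (hβ0 : 0 ≤ β) (hβ1 : β ≤ 1) (hs : 0 < s)
    (hst : s < t) : (t - s) ^ (a - 1) * s ^ (β - 1) ≤
      2 * t ^ (β - 1) * ((t - s) ^ (a - 1) + s ^ (a - 1)) := by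
  have ht : 0 < t := hs.trans hst
  have hts : 0 < t - s := sub_pos.2 hst
  rcases le_total (t / 2) s with h | h
  · calc (t - s) ^ (a - 1) * s ^ (β - 1) ≤ (t - s) ^ (a - 1) * (2 * t ^ (β - 1)) := by
          gcongr
          exact rpow_sub_one_le_of_half_le hβ0 hβ1 ht h
      _ = 2 * t ^ (β - 1) * (t - s) ^ (a - 1) := mul_comm _ _
      _ ≤ 2 * t ^ (β - 1) * ((t - s) ^ (a - 1) + s ^ (a - 1)) := by
          gcongr
          exact le_add_of_nonneg_right (by positivity)
  · have hswap : (t - s) ^ (a - 1) * s ^ (β - 1) ≤ (t - s) ^ (β - 1) * s ^ (a - 1) := by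
      have hmono : (t - s) ^ (a - β) ≤ s ^ (a - β) :=
        rpow_le_rpow_of_nonpos hs (by linarith) (sub_nonpos.2 haβ)
      rw [← sub_add_sub_cancel a β 1, rpow_add hts, rpow_add hs]
      calc (t - s) ^ (a - β) * (t - s) ^ (β - 1) * s ^ (β - 1)
          ≤ s ^ (a - β) * (t - s) ^ (β - 1) * s ^ (β - 1) := by gcongr
        _ = (t - s) ^ (β - 1) * (s ^ (a - β) * s ^ (β - 1)) := by ring
    calc (t - s) ^ (a - 1) * s ^ (β - 1) ≤ (t - s) ^ (β - 1) * s ^ (a - 1) := hswap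
      _ ≤ 2 * t ^ (β - 1) * s ^ (a - 1) := by
          gcongr
          exact rpow_sub_one_le_of_half_le hβ0 hβ1 ht (by linarith)
      _ ≤ 2 * t ^ (β - 1) * ((t - s) ^ (a - 1) + s ^ (a - 1)) := by
          gcongr
          exact le_add_of_nonneg_left (by positivity)

lemma integrable_mul_and_integral_abs_mul_le {X : Type*} [MeasurableSpace X] {μ : Measure X}
    {p q : ℝ} (hpq : p.HolderConjugate q) {g h : X → ℝ} (hg : AEStronglyMeasurable g μ)
    (hh : AEStronglyMeasurable h μ) (hgp : Integrable (fun s => |g s| ^ p) μ)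
    (hhq : Integrable (fun s => |h s| ^ q) μ) :
    Integrable (fun s => g s * h s) μ ∧
      ∫ s, |g s * h s| ∂μ ≤ (∫ s, |g s| ^ p ∂μ) + ∫ s, |h s| ^ q ∂μ := by
  have hyoung : ∀ s, |g s * h s| ≤ |g s| ^ p + |h s| ^ q := fun s => by
    rw [abs_mul]
    refine (Real.young_inequality_of_nonneg (abs_nonneg _) (abs_nonneg _) hpq).trans ?_
    exact add_le_add (div_le_self (by positivity) hpq.lt.le)
      (div_le_self (by positivity) hpq.symm.lt.le)
  have hint : Integrable (fun s => g s * h s) μ :=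
    (hgp.add hhq).mono' (hg.mul hh) (ae_of_all _ hyoung)
  exact ⟨hint, (integral_mono hint.abs (hgp.add hhq) hyoung).trans_eq (integral_add hgp hhq)⟩

lemma integrable_rpow_mul_and_integral_le {X : Type*} [MeasurableSpace X] {μ : Measure X}
    {p q c : ℝ} (hpq : p.HolderConjugate q) {z h : X → ℝ} (hzm : AEMeasurable z μ)
    (hz : ∀ᵐ s ∂μ, 0 ≤ z s) (hzi : Integrable (fun s => z s ^ (c * p)) μ)
    (hhm : AEStronglyMeasurable h μ) (hhq : Integrable (fun s => |h s| ^ q) μ) :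
    Integrable (fun s => z s ^ c * |h s|) μ ∧
      ∫ s, z s ^ c * |h s| ∂μ ≤ (∫ s, z s ^ (c * p) ∂μ) + ∫ s, |h s| ^ q ∂μ := by
  have hpow : (fun s => z s ^ (c * p)) =ᵐ[μ] fun s => |z s ^ c| ^ p := by
    filter_upwards [hz] with s hs
    rw [abs_of_nonneg (rpow_nonneg hs _), ← rpow_mul hs]
  obtain ⟨hint, hle⟩ := integrable_mul_and_integral_abs_mul_le hpq
    (hzm.pow_const c).aestronglyMeasurable hhm.norm (hzi.congr hpow)
    (by simpa only [Real.norm_eq_abs, abs_abs] using hhq)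
  simp only [Real.norm_eq_abs, abs_abs, ← integral_congr_ae hpow] at hint hle
  exact ⟨hint, (integral_mono hint hint.abs fun s => le_abs_self _).trans hle⟩

/-- Functions that satisfy an `AbelBound` on every bounded interval: the weights admitted in the
growth condition on the nonlinearity. -/
def IsAbelWeight (a β : ℝ) (φ : ℝ → ℝ) : Prop :=
  ∀ T : ℝ, 0 < T → ∃ C, AbelBound a β T C φ

lemma IsAbelWeight.add {a β : ℝ} {φ ψ : ℝ → ℝ} (hφ : IsAbelWeight a β φ)
    (hψ : IsAbelWeight a β ψ) : IsAbelWeight a β (fun s => φ s + ψ s) := fun T hT =>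
  let ⟨_, hC⟩ := hφ T hT
  let ⟨_, hD⟩ := hψ T hT
  ⟨_, hC.add hD⟩

lemma integrableOn_Ioc_rpow {r t : ℝ} (hr : -1 < r) (ht : 0 ≤ t) :
    IntegrableOn (fun s : ℝ => s ^ r) (Ioc 0 t) :=
  (intervalIntegrable_iff_integrableOn_Ioc_of_le ht).1
    (intervalIntegral.intervalIntegrable_rpow' hr)

lemma integral_Ioc_rpow {r t : ℝ} (hr : -1 < r) (ht : 0 ≤ t) :
    ∫ s in Ioc 0 t, s ^ r = t ^ (r + 1) / (r + 1) := by
  rw [← intervalIntegral.integral_of_le ht, integral_rpow (Or.inl hr),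
    zero_rpow (by linarith), sub_zero]

lemma integrableOn_Ioc_sub_rpow {r t : ℝ} (hr : -1 < r) (ht : 0 ≤ t) :
    IntegrableOn (fun s : ℝ => (t - s) ^ r) (Ioc 0 t) := by
  have h := (intervalIntegral.intervalIntegrable_rpow' (a := 0) (b := t) hr).comp_sub_left t
  simp only [sub_zero, sub_self] at h
  exact (intervalIntegrable_iff_integrableOn_Ioc_of_le ht).1 h.symm

lemma integral_Ioc_sub_rpow {r t : ℝ} (hr : -1 < r) (ht : 0 ≤ t) :
    ∫ s in Ioc 0 t, (t - s) ^ r = t ^ (r + 1) / (r + 1) := by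
  rw [← integral_Ioc_rpow hr ht, ← intervalIntegral.integral_of_le ht,
    ← intervalIntegral.integral_of_le ht,
    intervalIntegral.integral_comp_sub_left (fun s => s ^ r) t, sub_self, sub_zero]

lemma exists_integral_rpow_mul_abs_le {a p T : ℝ} {h : ℝ → ℝ} (hp1 : 1 < p) (hpa : 1 / p < a)
    (hh : MemLp h (ENNReal.ofReal p) (volume.restrict (Icc 0 T))) :
    ∃ N, ∀ t ∈ Ioc 0 T,
      (IntegrableOn (fun s => (t - s) ^ (a - 1) * |h s|) (Ioc 0 t) ∧
        ∫ s in Ioc 0 t, (t - s) ^ (a - 1) * |h s| ≤ N) ∧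
      IntegrableOn (fun s => s ^ (a - 1) * |h s|) (Ioc 0 t) ∧
        ∫ s in Ioc 0 t, s ^ (a - 1) * |h s| ≤ N := by
  have hpq : p.HolderConjugate p.conjExponent := Real.HolderConjugate.conjExponent hp1
  set q := p.conjExponent
  have hr : -1 < (a - 1) * q := by
    have hq : q⁻¹ = 1 - 1 / p := by rw [one_div, ← hpq.inv_add_inv_eq_one, add_sub_cancel_left]
    have hlt : (1 - a) * q < q⁻¹ * q := mul_lt_mul_of_pos_right (by linarith) hpq.symm.pos
    rw [inv_mul_cancel₀ hpq.symm.ne_zero] at hlt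
    linarith
  have hhp : IntegrableOn (fun s => |h s| ^ p) (Icc 0 T) := by
    simpa [ENNReal.toReal_ofReal hpq.nonneg, IntegrableOn] using
      hh.integrable_norm_rpow (by simpa using hpq.pos) ENNReal.ofReal_ne_top
  refine ⟨T ^ ((a - 1) * q + 1) / ((a - 1) * q + 1) + ∫ s in Icc 0 T, |h s| ^ p, fun t ht => ?_⟩
  have hsub : Ioc 0 t ⊆ Icc 0 T := Ioc_subset_Icc_self.trans (Icc_subset_Icc_right ht.2)
  have hle : t ^ ((a - 1) * q + 1) / ((a - 1) * q + 1) + ∫ s in Ioc 0 t, |h s| ^ p ≤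
      T ^ ((a - 1) * q + 1) / ((a - 1) * q + 1) + ∫ s in Icc 0 T, |h s| ^ p :=
    add_le_add (div_le_div_of_nonneg_right (rpow_le_rpow ht.1.le ht.2 (by linarith))
      (by linarith)) (setIntegral_mono_set hhp (ae_of_all _ fun s => by positivity)
        hsub.eventuallyLE)
  have hhm : AEStronglyMeasurable h (volume.restrict (Ioc 0 t)) :=
    hh.1.mono_measure (Measure.restrict_mono hsub le_rfl)
  obtain ⟨hint₁, hle₁⟩ := integrable_rpow_mul_and_integral_le hpq.symm (c := a - 1)
    (z := fun s => t - s) (by fun_prop)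
    ((ae_restrict_mem measurableSet_Ioc).mono fun s hs => sub_nonneg.2 hs.2)
    (integrableOn_Ioc_sub_rpow hr ht.1.le) hhm (hhp.mono_set hsub)
  obtain ⟨hint₂, hle₂⟩ := integrable_rpow_mul_and_integral_le hpq.symm (c := a - 1)
    (z := fun s => s) (by fun_prop)
    ((ae_restrict_mem measurableSet_Ioc).mono fun s hs => hs.1.le)
    (integrableOn_Ioc_rpow hr ht.1.le) hhm (hhp.mono_set hsub)
  rw [integral_Ioc_sub_rpow hr ht.1.le] at hle₁
  rw [integral_Ioc_rpow hr ht.1.le] at hle₂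
  exact ⟨⟨hint₁, hle₁.trans hle⟩, hint₂, hle₂.trans hle⟩

lemma ae_norm_sub_rpow_mul_le {a β t : ℝ} (haβ : a ≤ β) (hβ0 : 0 ≤ β) (hβ1 : β ≤ 1)
    (h : ℝ → ℝ) : ∀ᵐ s ∂volume.restrict (Ioc 0 t),
      ‖(t - s) ^ (a - 1) * (s ^ (β - 1) * |h s|)‖ ≤
        2 * t ^ (β - 1) * ((t - s) ^ (a - 1) * |h s| + s ^ (a - 1) * |h s|) := by
  filter_upwards [ae_restrict_Ioc_mem_Ioo 0 t] with s hs
  have hs0 := hs.1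
  have hts := sub_pos.2 hs.2
  rw [Real.norm_of_nonneg (by positivity), ← mul_assoc, ← add_mul, ← mul_assoc]
  exact mul_le_mul_of_nonneg_right (sub_rpow_mul_rpow_le haβ hβ0 hβ1 hs0 hs.2) (abs_nonneg _)

lemma isAbelWeight_of_memLp {a β p : ℝ} {h : ℝ → ℝ} (haβ : a ≤ β) (hβ1 : β ≤ 1) (hp1 : 1 < p)
    (hpa : 1 / p < a)
    (hh : ∀ T : ℝ, 0 < T → MemLp h (ENNReal.ofReal p) (volume.restrict (Icc 0 T))) :
    IsAbelWeight a β (fun s => s ^ (β - 1) * |h s|) := by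
  intro T hT
  have ha : 0 < a := (one_div_pos.2 (zero_lt_one.trans hp1)).trans hpa
  have hβ0 : 0 ≤ β := ha.le.trans haβ
  obtain ⟨N, hN⟩ := exists_integral_rpow_mul_abs_le hp1 hpa (hh T hT)
  have hN0 : 0 ≤ N := (setIntegral_nonneg measurableSet_Ioc fun s hs => by
    have := hs.1
    positivity).trans (hN T ⟨hT, le_rfl⟩).2.2
  have hkernel := fun t => ae_norm_sub_rpow_mul_le (t := t) haβ hβ0 hβ1 h
  have hdom : ∀ t ∈ Ioc 0 T, IntegrableOn (fun s =>
      2 * t ^ (β - 1) * ((t - s) ^ (a - 1) * |h s| + s ^ (a - 1) * |h s|)) (Ioc 0 t) :=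
    fun t ht => Integrable.const_mul ((hN t ht).1.1.add (hN t ht).2.1) _
  refine ⟨1 / Real.Gamma a * (4 * N), by positivity, fun t ht => ?_, fun t ht => ?_⟩
  · refine (hdom t ht).mono' ?_ (hkernel t)
    have hhm : AEStronglyMeasurable h (volume.restrict (Ioc 0 t)) := (hh T hT).1.mono_measure
      (Measure.restrict_mono (Ioc_subset_Icc_self.trans (Icc_subset_Icc_right ht.2)) le_rfl)
    have hm₁ : Measurable fun s : ℝ => (t - s) ^ (a - 1) := by fun_prop
    have hm₂ : Measurable fun s : ℝ => s ^ (β - 1) := by fun_prop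
    exact hm₁.aestronglyMeasurable.mul (hm₂.aestronglyMeasurable.mul hhm.norm)
  · have ht0 := ht.1
    rw [rlIntegral_eq_setIntegral _ _ ht.1.le, mul_assoc]
    gcongr
    calc ∫ s in Ioc 0 t, (t - s) ^ (a - 1) * (s ^ (β - 1) * |h s|)
        ≤ 2 * t ^ (β - 1) * ((∫ s in Ioc 0 t, (t - s) ^ (a - 1) * |h s|) +
            ∫ s in Ioc 0 t, s ^ (a - 1) * |h s|) := by
          rw [← integral_add (hN t ht).1.1 (hN t ht).2.1, ← integral_const_mul]
          exact (le_abs_self _).trans (norm_integral_le_of_norm_le (hdom t ht) (hkernel t))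
      _ ≤ 2 * t ^ (β - 1) * (N + N) := by
          gcongr
          exacts [(hN t ht).1.2, (hN t ht).2.2]
      _ = 4 * N * t ^ (β - 1) := by ring

/-! ### Existence by delayed approximations -/

lemma exists_tendsto_subseq_of_equicontinuous {X E : Type*} [TopologicalSpace X]
    [WeaklyLocallyCompactSpace X] [SigmaCompactSpace X] [MetricSpace E] [CompleteSpace E]
    {A : ℕ → C(X, E)} (hA : Equicontinuous fun n => ⇑(A n))
    (hcomp : ∀ x, ∃ Q, IsCompact Q ∧ ∀ n, A n x ∈ Q) :
    ∃ g : C(X, E), ∃ ψ : ℕ → ℕ, StrictMono ψ ∧ Tendsto (A ∘ ψ) atTop (𝓝 g) := by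
  have : T2Space (UniformOnFun X E {K | IsCompact K}) := UniformOnFun.t2Space_of_covering
    (eq_univ_of_forall fun x => mem_sUnion_of_mem (mem_singleton x) isCompact_singleton)
  have heq : Equicontinuous fun g : range A => ⇑(g : C(X, E)) := by
    simpa only [Function.comp_def, apply_rangeSplitting] using hA.comp (rangeSplitting A)
  have hrange : IsCompact (closure (range A)) :=
    ArzelaAscoli.isCompact_closure_of_isClosedEmbedding (fun K hK => hK)
      ContinuousMap.isUniformEmbedding_toUniformOnFunIsCompact.isClosedEmbedding
      (fun K _ => heq.equicontinuousOn K) fun _ _ x _ =>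
        (hcomp x).imp fun Q hQ => ⟨hQ.1, forall_mem_range.2 hQ.2⟩
  obtain ⟨g, -, ψ, hψ, hg⟩ := hrange.tendsto_subseq fun n => subset_closure (mem_range_self n)
  exact ⟨g, ψ, hψ, hg⟩

section MethodOfSteps

variable {X : Type*} {V : (ℝ → X) → ℝ → X} {δ : ℝ}

lemma iterate_eqOn_of_delay (hV : ∀ y z t, EqOn y z (Ioc (-δ) (t - δ)) → V y t = V z t) (x : X)
    {N m : ℕ} (hδ : 0 < δ) (hNm : N ≤ m) :
    EqOn (V^[m + 1] fun _ => x) (V^[N + 1] fun _ => x) (Iic (N * δ)) := by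
  have hsucc : ∀ k : ℕ, EqOn (V^[k + 2] fun _ => x) (V^[k + 1] fun _ => x) (Iic (k * δ)) := by
    intro k
    induction k with
    | zero =>
      intro t ht
      have ht : t ≤ 0 := by simpa using ht
      refine hV _ _ t fun s hs => ?_
      linarith [hs.1, hs.2]
    | succ k ih =>
      intro t ht
      rw [Function.iterate_succ_apply' V (k + 2), Function.iterate_succ_apply' V (k + 1)]
      refine hV _ _ t fun s hs => ?_
      rw [← Function.iterate_succ_apply' V (k + 1)]
      refine ih ?_
      simp only [mem_Iic, Nat.cast_succ, add_mul, one_mul] at ht ⊢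
      linarith [hs.2]
  induction m, hNm using Nat.le_induction with
  | base => exact eqOn_refl _ _
  | succ m hm ih =>
    refine ((hsucc m).mono (Iic_subset_Iic.2 ?_)).trans ih
    gcongr

lemma exists_continuous_fixedPoint_of_delay [TopologicalSpace X] [Nonempty X] (hδ : 0 < δ)
    (hV : ∀ y z t, EqOn y z (Ioc (-δ) (t - δ)) → V y t = V z t)
    (hc : ∀ y, Continuous y → Continuous (V y)) : ∃ y, Continuous y ∧ V y = y := by
  obtain ⟨x⟩ := ‹Nonempty X›
  let Y : ℕ → ℝ → X := fun m => V^[m + 1] fun _ => x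
  have hYc : ∀ m, Continuous (Y m) := by
    intro m
    induction m with
    | zero => exact hc _ continuous_const
    | succ m ih =>
      simp only [Y, Function.iterate_succ_apply' V (m + 1)]
      exact hc _ ih
  let y : ℝ → X := fun t => Y ⌈t / δ⌉₊ t
  have hyY : ∀ N : ℕ, EqOn y (Y N) (Iic (N * δ)) := by
    intro N t ht
    have htδ : t ≤ (⌈t / δ⌉₊ : ℝ) * δ := (div_le_iff₀ hδ).1 (Nat.le_ceil _)
    exact (iterate_eqOn_of_delay hV x hδ (le_max_left _ N) htδ).symm.trans
      (iterate_eqOn_of_delay hV x hδ (le_max_right _ N) ht)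
  have hlt : ∀ t : ℝ, ∃ N : ℕ, t < N * δ := fun t =>
    (exists_nat_gt (t / δ)).imp fun N hN => (div_lt_iff₀ hδ).1 hN
  refine ⟨y, continuous_iff_continuousAt.2 fun t => ?_, funext fun t => ?_⟩
  · obtain ⟨N, hN⟩ := hlt t
    exact (hYc N).continuousAt.congr
      ((hyY N).symm.eventuallyEq_of_mem (Iic_mem_nhds hN))
  · obtain ⟨N, hN⟩ := hlt t
    have hsucc : t ∈ Iic (((N + 1 : ℕ) : ℝ) * δ) := by
      simp only [mem_Iic, Nat.cast_succ, add_mul, one_mul]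
      linarith
    rw [hyY (N + 1) hsucc]
    simp only [Y, Function.iterate_succ_apply' V (N + 1)]
    exact hV _ _ t fun s hs => hyY N (by simp only [mem_Iic]; linarith [hs.2])

end MethodOfSteps

/-- `f` is continuous and has affine growth, governed by `φ`, in the weighted unknown
`v = s^(1-β) x`. -/
structure WeightedAffineGrowth (β : ℝ) (f : ℝ → ℝ → ℝ) (φ : ℝ → ℝ) : Prop where
  continuousOn : ContinuousOn (fun q : ℝ × ℝ => f q.1 q.2) (Ioi 0 ×ˢ univ)
  bound : ∀ s v : ℝ, 0 < s → |f s (s ^ (β - 1) * v)| ≤ φ s * (1 + |v|)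

/-- The right-hand side of the Volterra equation satisfied by `y(t) = t^(1-β) x(t)`, with the
argument of `y` delayed by `δ` under the integral (Tonelli's scheme). -/
noncomputable def delayedVolterra (β x₀ : ℝ) (f : ℝ → ℝ → ℝ) (δ : ℝ) (y : ℝ → ℝ) (t : ℝ) : ℝ :=
  x₀ + weightedRLIntegral β (fun s => f s (s ^ (β - 1) * y (s - δ))) t

section Existence

variable {a β x₀ : ℝ} {f : ℝ → ℝ → ℝ} {φ : ℝ → ℝ}

lemma WeightedAffineGrowth.nonneg (hf : WeightedAffineGrowth β f φ) {s : ℝ} (hs : 0 < s) :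
    0 ≤ φ s := by
  simpa using (abs_nonneg _).trans (hf.bound s 0 hs)

lemma continuousOn_rpow_Ioi (r : ℝ) : ContinuousOn (fun s : ℝ => s ^ r) (Ioi 0) :=
  continuousOn_id.rpow_const fun _ hs => Or.inl (ne_of_gt hs)

lemma WeightedAffineGrowth.continuousOn_comp (hf : WeightedAffineGrowth β f φ) {w : ℝ → ℝ}
    (hw : ContinuousOn w (Ioi 0)) : ContinuousOn (fun s => f s (s ^ (β - 1) * w s)) (Ioi 0) :=
  hf.continuousOn.comp (f := fun s => (s, s ^ (β - 1) * w s))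
    (continuousOn_id.prodMk ((continuousOn_rpow_Ioi _).mul hw)) fun _ hs => ⟨hs, mem_univ _⟩

lemma WeightedAffineGrowth.abelDominated {ι : Type*} (hf : WeightedAffineGrowth β f φ)
    (hφ : IsAbelWeight a β φ) {w : ι → ℝ → ℝ} (hw : ∀ i, ContinuousOn (w i) (Ioi 0))
    (hbdd : ∀ T, 0 < T → ∃ M, ∀ i, ∀ s ∈ Ioc 0 T, |w i s| ≤ M) :
    AbelDominated a β fun i s => f s (s ^ (β - 1) * w i s) := by
  intro T hT
  obtain ⟨M, hM⟩ := hbdd T hT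
  obtain ⟨C, hC⟩ := hφ T hT
  refine ⟨_, ⟨_, hC.const_mul (by positivity : 0 ≤ 1 + |M|)⟩, fun i => ⟨?_, fun s hs => ?_⟩⟩
  · exact ((hf.continuousOn_comp (hw i)).mono Ioc_subset_Ioi_self).aestronglyMeasurable
      measurableSet_Ioc
  · rw [mul_comm]
    exact (hf.bound s _ hs.1).trans (mul_le_mul_of_nonneg_left
      (by linarith [hM i s hs, le_abs_self M]) (hf.nonneg hs.1))

lemma delayedVolterra_of_nonpos {δ t : ℝ} {y : ℝ → ℝ} (ht : t ≤ 0) :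
    delayedVolterra β x₀ f δ y t = x₀ := by
  rw [delayedVolterra, weightedRLIntegral_of_nonpos _ _ ht, add_zero]

lemma delayedVolterra_congr {δ t : ℝ} {y z : ℝ → ℝ} (h : EqOn y z (Ioc (-δ) (t - δ))) :
    delayedVolterra β x₀ f δ y t = delayedVolterra β x₀ f δ z t := by
  rw [delayedVolterra, delayedVolterra, weightedRLIntegral, weightedRLIntegral,
    rlIntegral_congr (le_max_right _ _) fun s hs => ?_]
  have hst : s ≤ t := (le_max_iff.1 hs.2).resolve_right (not_le.2 hs.1)
  simp only [h ⟨by linarith [hs.1], sub_le_sub_right hst δ⟩]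

lemma exists_abs_comp_sub_le {y : ℝ → ℝ} (hy : Continuous y) (δ T : ℝ) :
    ∃ M, ∀ s ∈ Ioc 0 T, |y (s - δ)| ≤ M :=
  ((isCompact_Icc (a := 0) (b := T)).exists_bound_of_continuousOn
    (f := fun s => y (s - δ)) (by fun_prop)).imp
      fun _ hM s hs => hM s (Ioc_subset_Icc_self hs)

lemma delayedVolterra_continuous (ha : 0 < a) (haβ : a < β) (hβ1 : β < 1)
    (hf : WeightedAffineGrowth β f φ) (hφ : IsAbelWeight a β φ) (δ : ℝ) {y : ℝ → ℝ}
    (hy : Continuous y) : Continuous (delayedVolterra β x₀ f δ y) :=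
  continuous_const.add ((hf.abelDominated hφ (w := fun (_ : Unit) s => y (s - δ))
    (fun _ => by fun_prop)
    fun T _ => (exists_abs_comp_sub_le hy δ T).imp fun _ hM _ => hM).continuous ha haβ hβ1 ())

lemma exists_exp_weight_small (haβ : a < β) (K : ℝ) : ∃ l : ℝ, 0 < l ∧ K * l ^ (a - β) ≤ 1 / 2 := by
  have hlim := (tendsto_rpow_neg_atTop (sub_pos.2 haβ)).const_mul K
  rw [mul_zero, neg_sub] at hlim
  exact ((eventually_gt_atTop 0).and (hlim.eventually_le_const one_half_pos)).exists

lemma AbelBound.abs_weightedRLIntegral_le_of_exp {F : ℝ → ℝ} {T C l : ℝ} (ha : 0 < a)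
    (haβ : a ≤ β) (hβ1 : β ≤ 1) (hl : 0 < l) (hφ : AbelBound a β T C φ) {t : ℝ} (ht : t ∈ Ioc 0 T)
    (hF : ∀ s ∈ Ioc 0 t, |F s| ≤ Real.exp (l * s) * φ s) :
    |weightedRLIntegral β F t| ≤
      Real.Gamma a / Real.Gamma β * C * l ^ (a - β) * Real.exp (l * t) := by
  have ht0 : 0 < t := ht.1
  have hΓ : 0 ≤ Real.Gamma a / Real.Gamma β :=
    (div_pos (Real.Gamma_pos_of_pos ha) (Real.Gamma_pos_of_pos (ha.trans_le haβ))).le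
  rw [weightedRLIntegral_of_nonneg _ _ ht0.le, abs_mul, abs_of_nonneg (rpow_nonneg ht0.le _)]
  calc t ^ (1 - β) * |rlIntegral β F t|
      ≤ t ^ (1 - β) * (Real.Gamma a / Real.Gamma β * l ^ (a - β) * Real.exp (l * t) *
          (C * t ^ (β - 1))) := by
        refine mul_le_mul_of_nonneg_left ((abs_rlIntegral_le_of_exp ha haβ hβ1 hl ht0.le
          (hφ.rlIntegrable t ht) hF).trans ?_) (rpow_nonneg ht0.le _)
        exact mul_le_mul_of_nonneg_left (hφ.rlIntegral_le t ht) (by positivity)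
    _ = Real.Gamma a / Real.Gamma β * C * l ^ (a - β) * Real.exp (l * t) *
          (t ^ (1 - β) * t ^ (β - 1)) := by ring
    _ = _ := by rw [rpow_one_sub_mul_rpow_sub_one β ht0, mul_one]

lemma abs_delayedVolterra_le_of_exp {T C l B δ t : ℝ} {y : ℝ → ℝ} (ha : 0 < a) (haβ : a ≤ β)
    (hβ1 : β ≤ 1) (hf : WeightedAffineGrowth β f φ) (hφ : AbelBound a β T C φ) (hl : 0 < l)
    (hlC : Real.Gamma a / Real.Gamma β * C * l ^ (a - β) ≤ 1 / 2) (hB : 0 ≤ B)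
    (hy : ∀ s ∈ Ioc 0 T, |y (s - δ)| ≤ B * Real.exp (l * s)) (ht : t ∈ Icc 0 T) :
    |delayedVolterra β x₀ f δ y t| ≤ |x₀| + 1 / 2 * (1 + B) * Real.exp (l * t) := by
  rcases ht.1.eq_or_lt with rfl | ht0
  · rw [delayedVolterra_of_nonpos le_rfl]
    exact le_add_of_nonneg_right (by positivity)
  refine (abs_add_le _ _).trans (add_le_add_right ?_ _)
  have hF : ∀ s ∈ Ioc 0 t, |f s (s ^ (β - 1) * y (s - δ))| ≤
      Real.exp (l * s) * ((1 + B) * φ s) := by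
    intro s hs
    have hexp : 1 ≤ Real.exp (l * s) := Real.one_le_exp (mul_nonneg hl.le hs.1.le)
    calc |f s (s ^ (β - 1) * y (s - δ))| ≤ φ s * (1 + |y (s - δ)|) := hf.bound s _ hs.1
      _ ≤ φ s * (Real.exp (l * s) + B * Real.exp (l * s)) :=
          mul_le_mul_of_nonneg_left (add_le_add hexp (hy s ⟨hs.1, hs.2.trans ht.2⟩))
            (hf.nonneg hs.1)
      _ = Real.exp (l * s) * ((1 + B) * φ s) := by ring
  calc _ ≤ Real.Gamma a / Real.Gamma β * ((1 + B) * C) * l ^ (a - β) * Real.exp (l * t) :=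
        (hφ.const_mul (by positivity : 0 ≤ 1 + B)).abs_weightedRLIntegral_le_of_exp ha haβ hβ1 hl
          ⟨ht0, ht.2⟩ hF
    _ = Real.Gamma a / Real.Gamma β * C * l ^ (a - β) * ((1 + B) * Real.exp (l * t)) := by ring
    _ ≤ 1 / 2 * ((1 + B) * Real.exp (l * t)) := mul_le_mul_of_nonneg_right hlC (by positivity)
    _ = _ := by ring

lemma mul_exp_neg_le_of_le_add_mul_exp {u v c w : ℝ} (hv : 0 ≤ v) (hw : 0 ≤ w)
    (h : u ≤ v + c * Real.exp w) : u * Real.exp (-w) ≤ v + c :=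
  calc u * Real.exp (-w) ≤ (v + c * Real.exp w) * Real.exp (-w) :=
        mul_le_mul_of_nonneg_right h (Real.exp_pos _).le
    _ = v * Real.exp (-w) + c := by
        rw [add_mul, mul_assoc, ← Real.exp_add, add_neg_cancel, Real.exp_zero, mul_one]
    _ ≤ v + c := add_le_add_left
        (mul_le_of_le_one_right hv (Real.exp_le_one_iff.2 (neg_nonpos.2 hw))) _

lemma exists_bound_of_delayedVolterra_eq (ha : 0 < a) (haβ : a < β) (hβ1 : β < 1)
    (hf : WeightedAffineGrowth β f φ) (hφ : IsAbelWeight a β φ) (x₀ : ℝ) {T : ℝ} (hT : 0 < T) :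
    ∃ M, ∀ δ y, 0 ≤ δ → Continuous y → delayedVolterra β x₀ f δ y = y → ∀ t ≤ T, |y t| ≤ M := by
  obtain ⟨C, hC⟩ := hφ T hT
  obtain ⟨l, hl, hlC⟩ := exists_exp_weight_small haβ (Real.Gamma a / Real.Gamma β * C)
  refine ⟨(2 * |x₀| + 1) * Real.exp (l * T), fun δ y hδ hy hfix => ?_⟩
  obtain ⟨t₁, ht₁, hmax⟩ := (isCompact_Icc (a := 0) (b := T)).exists_isMaxOn
    (nonempty_Icc.2 hT.le) (f := fun t => |y t| * Real.exp (-(l * t))) (by fun_prop)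
  set B := |y t₁| * Real.exp (-(l * t₁))
  have hB : ∀ t ∈ Icc 0 T, |y t| ≤ B * Real.exp (l * t) := by
    intro t ht
    have h : |y t| * Real.exp (-(l * t)) ≤ B := hmax ht
    rwa [Real.exp_neg, ← div_eq_mul_inv, div_le_iff₀ (Real.exp_pos _)] at h
  have hneg : ∀ t ≤ 0, y t = x₀ := fun t ht => hfix ▸ delayedVolterra_of_nonpos ht
  have hy₀ : |x₀| ≤ B := by simpa [hneg 0 le_rfl] using hB 0 ⟨le_rfl, hT.le⟩
  have hB0 : 0 ≤ B := (abs_nonneg _).trans hy₀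
  have hdelay : ∀ s ∈ Ioc 0 T, |y (s - δ)| ≤ B * Real.exp (l * s) := by
    intro s hs
    rcases le_total (s - δ) 0 with h | h
    · rw [hneg _ h]
      exact hy₀.trans (le_mul_of_one_le_right hB0 (Real.one_le_exp (mul_nonneg hl.le hs.1.le)))
    · refine (hB _ ⟨h, by linarith [hs.2]⟩).trans ?_
      gcongr
      linarith
  have hself : B ≤ |x₀| + 1 / 2 * (1 + B) := by
    have h := abs_delayedVolterra_le_of_exp (x₀ := x₀) ha haβ.le hβ1.le hf hC hl hlC hB0 hdelay ht₁
    rw [hfix] at h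
    exact mul_exp_neg_le_of_le_add_mul_exp (abs_nonneg _) (mul_nonneg hl.le ht₁.1) h
  have hexpT : 1 ≤ Real.exp (l * T) := Real.one_le_exp (by positivity)
  intro t ht
  have hBle : B ≤ 2 * |x₀| + 1 := by linarith
  rcases le_total t 0 with h | h
  · rw [hneg t h]
    exact hy₀.trans (hBle.trans (le_mul_of_one_le_right (by positivity) hexpT))
  · refine (hB t ⟨h, ht⟩).trans ?_
    gcongr

lemma exists_delayedVolterra_eq (ha : 0 < a) (haβ : a < β) (hβ1 : β < 1)
    (hf : WeightedAffineGrowth β f φ) (hφ : IsAbelWeight a β φ) (x₀ : ℝ) {δ : ℝ} (hδ : 0 < δ) :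
    ∃ y : C(ℝ, ℝ), delayedVolterra β x₀ f δ y = y := by
  obtain ⟨y, hy, hfix⟩ := exists_continuous_fixedPoint_of_delay
    (V := delayedVolterra β x₀ f δ) hδ (fun _ _ _ h => delayedVolterra_congr h)
    fun _ hy => delayedVolterra_continuous ha haβ hβ1 hf hφ δ hy
  exact ⟨⟨y, hy⟩, hfix⟩

lemma delayedVolterra_eq_of_tendsto {d : ℕ → ℝ} {y : ℕ → C(ℝ, ℝ)} {g : C(ℝ, ℝ)} (haβ : a ≤ β)
    (hf : WeightedAffineGrowth β f φ)
    (hdom : AbelDominated a β fun n s => f s (s ^ (β - 1) * y n (s - d n)))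
    (hfix : ∀ n, delayedVolterra β x₀ f (d n) (y n) = y n) (hd : Tendsto d atTop (𝓝 0))
    (hy : Tendsto y atTop (𝓝 g)) : delayedVolterra β x₀ f 0 g = g := by
  have hF : ∀ s, 0 < s → Tendsto (fun n => f s (s ^ (β - 1) * y n (s - d n))) atTop
      (𝓝 (f s (s ^ (β - 1) * g (s - 0)))) := by
    intro s hs
    have hcont : ContinuousAt (fun q : ℝ × ℝ => f q.1 q.2) (s, s ^ (β - 1) * g (s - 0)) :=
      hf.continuousOn.continuousAt (prod_mem_nhds (Ioi_mem_nhds hs) univ_mem)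
    exact hcont.tendsto.comp (tendsto_const_nhds.prodMk_nhds
      ((hy.eval (hd.const_sub s)).const_mul _))
  funext t
  refine tendsto_nhds_unique ?_ (hy.eval (tendsto_const_nhds (x := t)))
  refine (Tendsto.congr fun n => congrFun (hfix n) t) ?_
  rcases le_or_gt t 0 with ht | ht
  · simp only [delayedVolterra_of_nonpos ht, tendsto_const_nhds]
  · simp only [delayedVolterra, weightedRLIntegral_of_nonneg _ _ ht.le]
    exact ((hdom.tendsto_rlIntegral haβ ht fun s hs => hF s hs.1).const_mul _).const_add _

lemma exists_continuous_volterra_eq (ha : 0 < a) (haβ : a < β) (hβ1 : β < 1)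
    (hf : WeightedAffineGrowth β f φ) (hφ : IsAbelWeight a β φ) (x₀ : ℝ) :
    ∃ y : C(ℝ, ℝ), delayedVolterra β x₀ f 0 y = y := by
  let d : ℕ → ℝ := fun n => 1 / ((n : ℝ) + 1)
  have hd : ∀ n, 0 < d n := fun n => Nat.one_div_pos_of_nat
  choose y hy using fun n => exists_delayedVolterra_eq ha haβ hβ1 hf hφ x₀ (hd n)
  have hbdd : ∀ T, 0 < T → ∃ M, ∀ n, ∀ t ≤ T, |y n t| ≤ M := fun T hT =>
    (exists_bound_of_delayedVolterra_eq ha haβ hβ1 hf hφ x₀ hT).imp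
      fun M hM n => hM (d n) (y n) (hd n).le (y n).continuous (hy n)
  have hdom : AbelDominated a β fun n s => f s (s ^ (β - 1) * y n (s - d n)) :=
    hf.abelDominated hφ (fun n => by fun_prop) fun T hT =>
      (hbdd T hT).imp fun M hM n s hs => hM n _ (by linarith [hs.2, hd n])
  have hequi : Equicontinuous fun n => ⇑(y n) := by
    rw [← funext hy]
    exact (isometry_add_left x₀).isUniformInducing.equicontinuous_iff.1
      (hdom.equicontinuous ha haβ hβ1)
  obtain ⟨g, ψ, hψ, hg⟩ := exists_tendsto_subseq_of_equicontinuous hequi fun t => by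
    obtain ⟨M, hM⟩ := hbdd (|t| + 1) (by positivity)
    exact ⟨Icc (-M) M, isCompact_Icc, fun n => abs_le.1 (hM n t (by linarith [le_abs_self t]))⟩
  exact ⟨g, delayedVolterra_eq_of_tendsto haβ.le hf (fun T hT => (hdom T hT).imp
    fun _ h => ⟨h.1, fun n => h.2 (ψ n)⟩) (fun n => hy (ψ n))
    (tendsto_one_div_add_atTop_nhds_zero_nat.comp hψ.tendsto_atTop) hg⟩

end Existence

/-- `x` is continuous on `(0,∞)` and solves the Volterra form
`x(t) = x₀ t^(β-1) + I^β f(·, x(·))(t)` of the initial value problem, with `t^(1-β) x(t) → x₀`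
as `t → 0+`. -/
structure IsVolterraSolution (β : ℝ) (f : ℝ → ℝ → ℝ) (x₀ : ℝ) (x : ℝ → ℝ) : Prop where
  continuousOn : ContinuousOn x (Ioi 0)
  initial : Tendsto (fun t => t ^ (1 - β) * x t) (𝓝[>] 0) (𝓝 x₀)
  rlIntegrable : ∀ t, 0 < t → RLIntegrable β (fun s => f s (x s)) t
  eq : ∀ t, 0 < t → x t = x₀ * t ^ (β - 1) + rlIntegral β (fun s => f s (x s)) t

lemma exists_isVolterraSolution {a β : ℝ} {f : ℝ → ℝ → ℝ} {φ : ℝ → ℝ} (ha : 0 < a) (haβ : a < β)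
    (hβ1 : β < 1) (hf : WeightedAffineGrowth β f φ) (hφ : IsAbelWeight a β φ) (x₀ : ℝ) :
    ∃ x, IsVolterraSolution β f x₀ x := by
  obtain ⟨y, hy⟩ := exists_continuous_volterra_eq ha haβ hβ1 hf hφ x₀
  have hy₀ : y 0 = x₀ := congrFun hy 0 ▸ delayedVolterra_of_nonpos le_rfl
  have hdom : AbelDominated a β fun (_ : Unit) s => f s (s ^ (β - 1) * y s) :=
    hf.abelDominated hφ (fun _ => by fun_prop) fun T _ => by
      simpa using exists_abs_comp_sub_le y.continuous 0 T
  refine ⟨fun t => t ^ (β - 1) * y t, (continuousOn_rpow_Ioi _).mul y.continuous.continuousOn, ?_,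
    fun t ht => hdom.rlIntegrable haβ.le () ht, fun t ht => ?_⟩
  · have hlim : Tendsto y (𝓝[>] 0) (𝓝 x₀) :=
      hy₀ ▸ y.continuous.continuousAt.tendsto.mono_left nhdsWithin_le_nhds
    refine hlim.congr' ?_
    filter_upwards [self_mem_nhdsWithin] with t ht
    rw [← mul_assoc, rpow_one_sub_mul_rpow_sub_one β ht, one_mul]
  · have hyt : x₀ + t ^ (1 - β) * rlIntegral β (fun s => f s (s ^ (β - 1) * y s)) t = y t := by
      simpa only [delayedVolterra, weightedRLIntegral_of_nonneg _ _ ht.le, sub_zero]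
        using congrFun hy t
    rw [← hyt]
    linear_combination rlIntegral β (fun s => f s (s ^ (β - 1) * y s)) t *
      rpow_one_sub_mul_rpow_sub_one β ht

lemma IsVolterraSolution.isRLSolution {β x₀ : ℝ} {f : ℝ → ℝ → ℝ} {x : ℝ → ℝ} (hβ : 0 < β)
    (hβ1 : β < 1) (hf : ContinuousOn (fun q : ℝ × ℝ => f q.1 q.2) (Ioi 0 ×ˢ univ))
    (hx : IsVolterraSolution β f x₀ x) : IsRLSolution β f x₀ x :=
  ⟨hasRLDeriv_of_volterra hβ hβ1
    (hf.comp (f := fun s => (s, x s)) (continuousOn_id.prodMk hx.continuousOn)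
      fun _ hs => ⟨hs, mem_univ _⟩)
    (fun T hT => (hx.rlIntegrable T hT).integrableOn hβ1.le) hx.eq, hx.initial⟩

/-! ### Behaviour at infinity -/

lemma rlIntegrable_indicator_Ioc (α : ℝ) {T t : ℝ} {F : ℝ → ℝ} (ht : T < t)
    (hF : IntegrableOn F (Ioc 0 T)) : RLIntegrable α ((Ioc 0 T).indicator F) t := by
  have hkernel : ContinuousOn (fun s => (t - s) ^ (α - 1)) (Icc 0 T) :=
    (continuousOn_const.sub continuousOn_id).rpow_const fun s hs =>
      Or.inl (sub_pos.2 (hs.2.trans_lt ht)).ne'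
  have hint := ((integrableOn_Icc_iff_integrableOn_Ioc (by simp)).2 hF).continuousOn_mul hkernel
    isCompact_Icc
  have hind := (hint.mono_set Ioc_subset_Icc_self).integrable_indicator measurableSet_Ioc
  exact hind.integrableOn.congr (ae_of_all _ fun s => indicator_mul_right _ _ F)

lemma rlIntegral_indicator_Ioc_le {α T t : ℝ} {F : ℝ → ℝ} (hα : 0 < α) (hα1 : α ≤ 1)
    (hT : 0 ≤ T) (ht : T < t) (hF : IntegrableOn F (Ioc 0 T)) (hF0 : ∀ s ∈ Ioc 0 T, 0 ≤ F s) :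
    rlIntegral α ((Ioc 0 T).indicator F) t ≤
      (t - T) ^ (α - 1) * (1 / Real.Gamma α * ∫ s in Ioc 0 T, F s) := by
  have hsub : Ioc 0 t ∩ Ioc 0 T = Ioc 0 T := inter_eq_right.2 (Ioc_subset_Ioc_right ht.le)
  have hint : IntegrableOn (fun s => (t - s) ^ (α - 1) * F s) (Ioc 0 T) :=
    ((rlIntegrable_indicator_Ioc α ht hF).mono_set (Ioc_subset_Ioc_right ht.le)).congr_fun
      (fun s hs => by simp only [indicator_of_mem hs]) measurableSet_Ioc
  have hΓ : 0 ≤ 1 / Real.Gamma α := (one_div_pos.2 (Real.Gamma_pos_of_pos hα)).le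
  rw [rlIntegral_eq_setIntegral _ _ (hT.trans ht.le), mul_left_comm]
  simp only [← indicator_mul_right (Ioc 0 T) fun s => (t - s) ^ (α - 1)]
  rw [setIntegral_indicator measurableSet_Ioc, hsub, ← integral_const_mul ((t - T) ^ (α - 1))]
  refine mul_le_mul_of_nonneg_left (setIntegral_mono_on hint (hF.const_mul _) measurableSet_Ioc
    fun s hs => mul_le_mul_of_nonneg_right ?_ (hF0 s hs)) hΓ
  exact rpow_le_rpow_of_nonpos (sub_pos.2 ht) (by linarith [hs.2]) (by linarith)

lemma abs_rlIntegral_le_of_tail {β T t : ℝ} {F ψ : ℝ → ℝ} (hβ : 0 < β) (hβ1 : β ≤ 1)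
    (hT : 0 ≤ T) (ht : T < t) (hF : IntegrableOn F (Ioc 0 T)) (hψ : RLIntegrable β ψ t)
    (hψ0 : ∀ s ∈ Ioc 0 T, 0 ≤ ψ s) (hFψ : ∀ s ∈ Ioc T t, |F s| ≤ ψ s) :
    |rlIntegral β F t| ≤
      (t - T) ^ (β - 1) * (1 / Real.Gamma β * ∫ s in Ioc 0 T, |F s|) + rlIntegral β ψ t := by
  have ht0 : 0 < t := hT.trans_lt ht
  have hhead := rlIntegrable_indicator_Ioc β ht hF.abs
  have hle : ∀ s ∈ Ioc 0 t, |F s| ≤ (Ioc 0 T).indicator (fun s => |F s|) s + ψ s := by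
    intro s hs
    rcases le_or_gt s T with h | h
    · rw [indicator_of_mem (show s ∈ Ioc 0 T from ⟨hs.1, h⟩)]
      exact le_add_of_nonneg_right (hψ0 s ⟨hs.1, h⟩)
    · rw [indicator_of_notMem fun hs' => h.not_ge hs'.2, zero_add]
      exact hFψ s ⟨h, hs.2⟩
  have habs := abs_rlIntegral_le hβ le_rfl ht0.le (hhead.add hψ) hle
  rw [div_self (Real.Gamma_pos_of_pos hβ).ne', sub_self, rpow_zero, one_mul, one_mul,
    rlIntegral_add ht0.le hhead hψ] at habs
  exact habs.trans (add_le_add_left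
    (rlIntegral_indicator_Ioc_le hβ hβ1 hT ht hF.abs fun _ _ => abs_nonneg _) _)

section Asymptotics

variable {β : ℝ}

lemma rlIntegral_rpow_neg (hβ : 0 < β) (hβ1 : β < 1) {t : ℝ} (ht : 0 < t) :
    rlIntegral β (fun s => s ^ (-β)) t = Real.Gamma (1 - β) := by
  rw [rlIntegral_rpow hβ (by linarith) ht, add_neg_cancel, zero_add, Real.Gamma_one, rpow_zero,
    div_one, mul_one, neg_add_eq_sub]

lemma abs_rlIntegral_le_of_tail_rpow (hβ : 0 < β) (hβ1 : β < 1) {T t η : ℝ} {F : ℝ → ℝ}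
    (hT : 0 ≤ T) (ht : T < t) (hη : 0 ≤ η) (hF : IntegrableOn F (Ioc 0 T))
    (hFη : ∀ s ∈ Ioc T t, |F s| ≤ η * s ^ (-β)) :
    |rlIntegral β F t| ≤ (t - T) ^ (β - 1) * (1 / Real.Gamma β * ∫ s in Ioc 0 T, |F s|) +
      η * Real.Gamma (1 - β) := by
  have ht0 : 0 < t := hT.trans_lt ht
  rw [← rlIntegral_rpow_neg hβ hβ1 ht0, ← rlIntegral_const_mul]
  exact abs_rlIntegral_le_of_tail hβ hβ1.le hT ht hF
    ((rlIntegrable_rpow hβ (by linarith) ht0).const_mul η)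
    (fun s hs => mul_nonneg hη (rpow_nonneg hs.1.le _)) hFη

lemma eventually_abs_le_mul_rpow_neg {F : ℝ → ℝ} {b η : ℝ}
    (hF : Tendsto (fun t => t ^ β * F t) atTop (𝓝 b)) (hη : |b| < η) :
    ∀ᶠ t in atTop, |F t| ≤ η * t ^ (-β) := by
  filter_upwards [hF.abs.eventually_le_const hη, eventually_gt_atTop 0] with t ht ht0
  rwa [abs_mul, abs_of_pos (rpow_pos_of_pos ht0 β), ← le_div_iff₀' (rpow_pos_of_pos ht0 β),
    div_eq_mul_inv, ← rpow_neg ht0.le] at ht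

lemma tendsto_sub_rpow_sub_one_mul (hβ1 : β < 1) (T c : ℝ) :
    Tendsto (fun t : ℝ => (t - T) ^ (β - 1) * c) atTop (𝓝 0) := by
  have hpow := (tendsto_rpow_neg_atTop (sub_pos.2 hβ1)).comp
    (tendsto_atTop_add_const_right _ (-T) tendsto_id)
  simpa [Function.comp_def, sub_eq_add_neg] using hpow.mul_const c

lemma tendsto_rlIntegral_zero (hβ : 0 < β) (hβ1 : β < 1) {F : ℝ → ℝ}
    (hF : ∀ t, 0 < t → RLIntegrable β F t)
    (hlim : Tendsto (fun t => t ^ β * F t) atTop (𝓝 0)) :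
    Tendsto (rlIntegral β F) atTop (𝓝 0) := by
  have hΓ := Real.Gamma_pos_of_pos (sub_pos.2 hβ1)
  rw [Metric.tendsto_nhds]
  intro ε hε
  have hη : 0 < ε / 2 / Real.Gamma (1 - β) := by positivity
  obtain ⟨T, hT⟩ := eventually_atTop.1
    ((eventually_abs_le_mul_rpow_neg hlim (by rwa [abs_zero])).and (eventually_gt_atTop 0))
  have hT0 : 0 < T := (hT T le_rfl).2
  have hhead := tendsto_sub_rpow_sub_one_mul hβ1 T
    (1 / Real.Gamma β * ∫ s in Ioc 0 T, |F s|)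
  filter_upwards [hhead.eventually_lt_const (half_pos hε), eventually_gt_atTop T] with t ht hTt
  rw [dist_zero_right, Real.norm_eq_abs, ← add_halves ε]
  refine (abs_rlIntegral_le_of_tail_rpow hβ hβ1 hT0.le hTt hη.le
    ((hF T hT0).integrableOn hβ1.le) fun s hs => (hT s hs.1.le).1).trans_lt ?_
  rw [div_mul_cancel₀ _ hΓ.ne']
  exact add_lt_add_left ht _

lemma tendsto_rlIntegral_atTop (hβ : 0 < β) (hβ1 : β < 1) {b : ℝ} {F : ℝ → ℝ}
    (hF : ∀ t, 0 < t → RLIntegrable β F t)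
    (hlim : Tendsto (fun t => t ^ β * F t) atTop (𝓝 b)) :
    Tendsto (rlIntegral β F) atTop (𝓝 (b * Real.Gamma (1 - β))) := by
  have hpow : ∀ c t, 0 < t → RLIntegrable β (fun s => c * s ^ (-β)) t := fun c t ht =>
    (rlIntegrable_rpow hβ (by linarith) ht).const_mul c
  have hrem := tendsto_rlIntegral_zero hβ hβ1 (F := fun s => F s + -b * s ^ (-β))
    (fun t ht => (hF t ht).add (hpow _ t ht)) <| by
      refine (sub_self b ▸ hlim.sub_const b).congr' ?_
      filter_upwards [eventually_gt_atTop 0] with t ht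
      have hinv : t ^ β * t ^ (-β) = 1 := by rw [← rpow_add ht, add_neg_cancel, rpow_zero]
      linear_combination b * hinv
  refine (zero_add (b * Real.Gamma (1 - β)) ▸ hrem.add_const _).congr' ?_
  filter_upwards [eventually_gt_atTop 0] with t ht
  rw [rlIntegral_add ht.le (hF t ht) (hpow _ t ht), rlIntegral_const_mul,
    rlIntegral_rpow_neg hβ hβ1 ht]
  ring

variable {x₀ : ℝ} {f : ℝ → ℝ → ℝ} {x : ℝ → ℝ}

lemma IsVolterraSolution.abs_le (hβ : 0 < β) (hβ1 : β < 1) (hx : IsVolterraSolution β f x₀ x)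
    {T t A : ℝ} (hT : 0 < T) (ht : T + 1 ≤ t) (hA : 0 ≤ A)
    (hfA : ∀ s ∈ Ioc T t, |f s (x s)| ≤ A * s ^ (-β)) :
    |x t| ≤ |x₀| + 1 / Real.Gamma β * (∫ s in Ioc 0 T, |f s (x s)|) + A * Real.Gamma (1 - β) := by
  have ht0 : 0 < t := by linarith
  have hΓ : 0 ≤ 1 / Real.Gamma β := (one_div_pos.2 (Real.Gamma_pos_of_pos hβ)).le
  have hpow : ∀ r : ℝ, 1 ≤ r → r ^ (β - 1) ≤ 1 := fun r hr =>
    rpow_le_one_of_one_le_of_nonpos hr (sub_nonpos.2 hβ1.le)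
  have hhom : |x₀ * t ^ (β - 1)| ≤ |x₀| := by
    rw [abs_mul, abs_of_pos (rpow_pos_of_pos ht0 _)]
    exact mul_le_of_le_one_right (abs_nonneg _) (hpow t (by linarith))
  have hint := abs_rlIntegral_le_of_tail_rpow hβ hβ1 hT.le (by linarith) hA
    ((hx.rlIntegrable T hT).integrableOn hβ1.le) hfA
  have hhead := mul_le_of_le_one_left
    (mul_nonneg hΓ (integral_nonneg (μ := volume.restrict (Ioc 0 T)) fun s =>
      abs_nonneg (f s (x s)))) (hpow (t - T) (by linarith))
  rw [hx.eq t ht0]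
  exact (abs_add_le _ _).trans (by linarith)

lemma IsVolterraSolution.exists_bound (hβ : 0 < β) (hβ1 : β < 1)
    (hx : IsVolterraSolution β f x₀ x) {η C : ℝ} (hη : 0 ≤ η)
    (hηβ : η * Real.Gamma (1 - β) < 1)
    (hf : ∀ᶠ s in atTop, |f s (x s)| ≤ (η * |x s| + C) * s ^ (-β)) :
    ∃ M, ∀ᶠ t in atTop, |x t| ≤ M := by
  obtain ⟨T, hT⟩ := eventually_atTop.1 (hf.and (eventually_gt_atTop 0))
  have hT0 : 0 < T := (hT T le_rfl).2
  have hcont : ∀ S, ContinuousOn x (Icc T S) := fun S =>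
    hx.continuousOn.mono fun s hs => hT0.trans_le hs.1
  obtain ⟨B, hB⟩ := (isCompact_Icc (a := T) (b := T + 1)).exists_bound_of_continuousOn (hcont _)
  set D := |x₀| + 1 / Real.Gamma β * (∫ s in Ioc 0 T, |f s (x s)|) + C * Real.Gamma (1 - β)
    with hD
  refine ⟨max B (D / (1 - η * Real.Gamma (1 - β))),
    (eventually_ge_atTop T).mono fun t ht => ?_⟩
  obtain ⟨m, hm, hmax⟩ := (isCompact_Icc (a := T) (b := t)).exists_isMaxOn ⟨t, ht, le_rfl⟩
    (hcont t).abs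
  refine (show |x t| ≤ |x m| from hmax ⟨ht, le_rfl⟩).trans ?_
  rcases le_total m (T + 1) with h | h
  · exact le_max_of_le_left (hB m ⟨hm.1, h⟩)
  have hA : 0 ≤ η * |x m| + C :=
    nonneg_of_mul_nonneg_left ((abs_nonneg _).trans (hT m hm.1).1)
      (rpow_pos_of_pos (hT0.trans_le hm.1) _)
  have hself := hx.abs_le hβ hβ1 hT0 h hA fun s hs =>
    (hT s hs.1.le).1.trans (mul_le_mul_of_nonneg_right
      (add_le_add_left (mul_le_mul_of_nonneg_left (hmax ⟨hs.1.le, hs.2.trans hm.2⟩) hη) C)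
      (rpow_nonneg (hT0.trans hs.1).le _))
  refine le_max_of_le_right ((le_div_iff₀ (sub_pos.2 hηβ)).2 ?_)
  rw [hD]
  linarith

lemma IsVolterraSolution.tendsto (hβ : 0 < β) (hβ1 : β < 1) (hx : IsVolterraSolution β f x₀ x)
    {b : ℝ} (hlim : Tendsto (fun t => t ^ β * f t (x t)) atTop (𝓝 b)) :
    Tendsto x atTop (𝓝 (b * Real.Gamma (1 - β))) := by
  have hhom := tendsto_sub_rpow_sub_one_mul hβ1 0 x₀
  have hsum := hhom.add (tendsto_rlIntegral_atTop hβ hβ1 hx.rlIntegrable hlim)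
  rw [zero_add] at hsum
  refine hsum.congr' ?_
  filter_upwards [eventually_gt_atTop 0] with t ht
  rw [hx.eq t ht, sub_zero, mul_comm]

end Asymptotics

lemma IsRealPower.abs_eq {μ : ℝ} {P : ℝ → ℝ} (hP : IsRealPower μ P) (x : ℝ) :
    |P x| = |x| ^ μ := by
  rcases le_or_gt 0 x with h | h
  · rw [hP.1 x h, abs_of_nonneg h, abs_of_nonneg (rpow_nonneg h μ)]
  · exact hP.2 x h

lemma rpow_le_one_add {μ z : ℝ} (hμ₀ : 0 ≤ μ) (hμ₁ : μ ≤ 1) (hz : 0 ≤ z) : z ^ μ ≤ 1 + z := by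
  rcases le_total z 1 with h | h
  · linarith [rpow_le_one hz h hμ₀]
  · linarith [rpow_le_self_of_one_le h hμ₁]

lemma tendsto_rpow_mul_of_rpow_mul_abs_le {β γ K : ℝ} {l : ℝ → ℝ} (hβγ : β < γ)
    (hl : ∀ t : ℝ, 1 ≤ t → t ^ γ * |l t| ≤ K) :
    Tendsto (fun t => t ^ β * l t) atTop (𝓝 0) := by
  have hlim := (tendsto_rpow_neg_atTop (sub_pos.2 hβγ)).mul_const K
  rw [zero_mul] at hlim
  refine squeeze_zero_norm' ?_ hlim
  filter_upwards [eventually_ge_atTop 1] with t ht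
  have ht0 : 0 < t := zero_lt_one.trans_le ht
  rw [norm_mul, Real.norm_of_nonneg (rpow_nonneg ht0.le β), Real.norm_eq_abs]
  calc t ^ β * |l t| = t ^ (-(γ - β)) * (t ^ γ * |l t|) := by
        rw [← mul_assoc, ← rpow_add ht0, neg_sub, sub_add_cancel]
    _ ≤ t ^ (-(γ - β)) * K := mul_le_mul_of_nonneg_left (hl t ht) (rpow_nonneg ht0.le _)

lemma mul_Gamma_one_sub {β : ℝ} (hβ : 0 < β) (b : ℝ) :
    b * Real.Gamma (1 - β) = b * π / (Real.Gamma β * Real.sin (β * π)) := by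
  rw [mul_div_mul_comm, mul_comm β π, ← Real.Gamma_mul_Gamma_one_sub, ← mul_assoc,
    div_mul_cancel₀ _ (Real.Gamma_pos_of_pos hβ).ne']

lemma abs_le_of_sandwich {u v L L₁ κ κ₁ : ℝ} (hlower : L₁ * v + κ₁ ≤ u) (hupper : u ≤ L * v + κ) :
    |u| ≤ (|L| + |L₁|) * |v| + (|κ| + |κ₁|) := by
  have hL : |L * v + κ| ≤ |L| * |v| + |κ| := abs_mul L v ▸ abs_add_le _ _
  have hL₁ : |L₁ * v + κ₁| ≤ |L₁| * |v| + |κ₁| := abs_mul L₁ v ▸ abs_add_le _ _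
  have hLv : 0 ≤ |L| * |v| := by positivity
  have hL₁v : 0 ≤ |L₁| * |v| := by positivity
  exact (abs_le_max_abs_abs hlower hupper).trans
    (max_le (by linarith [abs_nonneg κ]) (by linarith [abs_nonneg κ₁]))

section Sandwich

variable {β μ b : ℝ} {P l l₁ k k₁ : ℝ → ℝ} {f : ℝ → ℝ → ℝ}

lemma weightedAffineGrowth_of_sandwich (hμ₀ : 0 ≤ μ) (hμ₁ : μ ≤ 1) (hP : ∀ x, |P x| ≤ |x| ^ μ)
    (hf : ContinuousOn (fun q : ℝ × ℝ => f q.1 q.2) (Ioi 0 ×ˢ univ))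
    (hfb : ∀ t x : ℝ, 0 < t → l₁ t * P x + k₁ t ≤ f t x ∧ f t x ≤ l t * P x + k t) :
    WeightedAffineGrowth β f (fun s =>
      (s ^ (β - 1) * |s ^ ((1 - μ) * (1 - β)) * l s| +
        s ^ (β - 1) * |s ^ ((1 - μ) * (1 - β)) * l₁ s|) +
      (s ^ (β - 1) * |s ^ (1 - β) * k s| + s ^ (β - 1) * |s ^ (1 - β) * k₁ s|)) := by
  refine ⟨hf, fun s v hs => ?_⟩
  have hpos : ∀ r : ℝ, 0 ≤ s ^ r := fun r => rpow_nonneg hs.le r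
  have hunit := rpow_one_sub_mul_rpow_sub_one β hs
  have hweight : (s ^ (β - 1)) ^ μ = s ^ (β - 1) * s ^ ((1 - μ) * (1 - β)) := by
    rw [← rpow_mul hs.le, ← rpow_add hs]
    ring_nf
  have hPv : |P (s ^ (β - 1) * v)| ≤ s ^ (β - 1) * s ^ ((1 - μ) * (1 - β)) * (1 + |v|) := by
    refine (hP _).trans ?_
    rw [abs_mul, abs_of_nonneg (hpos _), mul_rpow (hpos _) (abs_nonneg v), hweight]
    exact mul_le_mul_of_nonneg_left (rpow_le_one_add hμ₀ hμ₁ (abs_nonneg v))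
      (mul_nonneg (hpos _) (hpos _))
  have hk : |k s| + |k₁ s| ≤ (|k s| + |k₁ s|) * (1 + |v|) :=
    le_mul_of_one_le_right (by positivity) (le_add_of_nonneg_right (abs_nonneg v))
  obtain ⟨hlower, hupper⟩ := hfb s (s ^ (β - 1) * v) hs
  simp only [abs_mul, abs_of_nonneg (hpos _)]
  calc |f s (s ^ (β - 1) * v)|
      ≤ (|l s| + |l₁ s|) * |P (s ^ (β - 1) * v)| + (|k s| + |k₁ s|) :=
        abs_le_of_sandwich hlower hupper
    _ ≤ (|l s| + |l₁ s|) * (s ^ (β - 1) * s ^ ((1 - μ) * (1 - β)) * (1 + |v|)) +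
        (|k s| + |k₁ s|) * (1 + |v|) :=
        add_le_add (mul_le_mul_of_nonneg_left hPv (by positivity)) hk
    _ = _ := by linear_combination (-(|k s| + |k₁ s|) * (1 + |v|)) * hunit

lemma exists_eventually_abs_le_of_sandwich (hP : ∀ x, |P x| ≤ 1 + |x|)
    (hl : Tendsto (fun t => t ^ β * l t) atTop (𝓝 0))
    (hl₁ : Tendsto (fun t => t ^ β * l₁ t) atTop (𝓝 0))
    (hk : Tendsto (fun t => t ^ β * k t) atTop (𝓝 b))
    (hk₁ : Tendsto (fun t => t ^ β * k₁ t) atTop (𝓝 b))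
    (hfb : ∀ t x : ℝ, 0 < t → l₁ t * P x + k₁ t ≤ f t x ∧ f t x ≤ l t * P x + k t)
    {η : ℝ} (hη : 0 < η) :
    ∃ C, ∀ᶠ s in atTop, ∀ x, |f s x| ≤ (η * |x| + C) * s ^ (-β) := by
  have hη2 : |(0 : ℝ)| < η / 2 := by simpa using hη
  refine ⟨η + 2 * (|b| + 1), ?_⟩
  filter_upwards [eventually_abs_le_mul_rpow_neg hl hη2, eventually_abs_le_mul_rpow_neg hl₁ hη2,
    eventually_abs_le_mul_rpow_neg hk (lt_add_one |b|),
    eventually_abs_le_mul_rpow_neg hk₁ (lt_add_one |b|), eventually_gt_atTop 0]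
    with s hls hl₁s hks hk₁s hs x
  have hlx : (|l s| + |l₁ s|) * |P x| ≤ η * s ^ (-β) * (1 + |x|) :=
    mul_le_mul (by linarith) (hP x) (abs_nonneg _) (by positivity)
  linarith [abs_le_of_sandwich (hfb s x hs).1 (hfb s x hs).2]

lemma tendsto_of_sandwich (hP : ∀ x, |P x| ≤ 1 + |x|)
    (hl : Tendsto (fun t => t ^ β * l t) atTop (𝓝 0))
    (hl₁ : Tendsto (fun t => t ^ β * l₁ t) atTop (𝓝 0))
    (hk : Tendsto (fun t => t ^ β * k t) atTop (𝓝 b))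
    (hk₁ : Tendsto (fun t => t ^ β * k₁ t) atTop (𝓝 b))
    (hfb : ∀ t x : ℝ, 0 < t → l₁ t * P x + k₁ t ≤ f t x ∧ f t x ≤ l t * P x + k t)
    {x : ℝ → ℝ} (hx : ∃ M, ∀ᶠ t in atTop, |x t| ≤ M) :
    Tendsto (fun t => t ^ β * f t (x t)) atTop (𝓝 b) := by
  obtain ⟨M, hM⟩ := hx
  have hPx : ∀ᶠ t in atTop, ‖P (x t)‖ ≤ 1 + M :=
    hM.mono fun t ht => (hP _).trans (add_le_add_right ht 1)
  have hmain : ∀ {L κ : ℝ → ℝ}, Tendsto (fun t => t ^ β * L t) atTop (𝓝 0) →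
      Tendsto (fun t => t ^ β * κ t) atTop (𝓝 b) →
      Tendsto (fun t => t ^ β * (L t * P (x t) + κ t)) atTop (𝓝 b) := by
    intro L κ hL hκ
    have hsum := (hL.zero_mul_isBoundedUnder_le (isBoundedUnder_of_eventually_le hPx)).add hκ
    simpa only [zero_add, mul_add, mul_assoc] using hsum
  refine tendsto_of_tendsto_of_tendsto_of_le_of_le' (hmain hl₁ hk₁) (hmain hl hk) ?_ ?_ <;>
    filter_upwards [eventually_gt_atTop 0] with t ht
  · exact mul_le_mul_of_nonneg_left (hfb t (x t) ht).1 (rpow_nonneg ht.le β)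
  · exact mul_le_mul_of_nonneg_left (hfb t (x t) ht).2 (rpow_nonneg ht.le β)

end Sandwich

theorem theorem3p7_general {β μ p b : ℝ} (hβ : 0 < β) (hβ1 : β < 1) (hμ₀ : 0 ≤ μ) (hμ₁ : μ ≤ 1)
    (hp : 1 / β < p) {P l l₁ k k₁ : ℝ → ℝ} {f : ℝ → ℝ → ℝ} (hP : ∀ x, |P x| ≤ |x| ^ μ)
    (hl : ∀ T, 0 < T → MemLp (fun t => t ^ ((1 - μ) * (1 - β)) * l t) (ENNReal.ofReal p)
      (volume.restrict (Icc 0 T)))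
    (hl₁ : ∀ T, 0 < T → MemLp (fun t => t ^ ((1 - μ) * (1 - β)) * l₁ t) (ENNReal.ofReal p)
      (volume.restrict (Icc 0 T)))
    (hk : ∀ T, 0 < T → MemLp (fun t => t ^ (1 - β) * k t) (ENNReal.ofReal p)
      (volume.restrict (Icc 0 T)))
    (hk₁ : ∀ T, 0 < T → MemLp (fun t => t ^ (1 - β) * k₁ t) (ENNReal.ofReal p)
      (volume.restrict (Icc 0 T)))
    (hl0 : Tendsto (fun t => t ^ β * l t) atTop (𝓝 0))
    (hl₁0 : Tendsto (fun t => t ^ β * l₁ t) atTop (𝓝 0))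
    (hkb : Tendsto (fun t => t ^ β * k t) atTop (𝓝 b))
    (hk₁b : Tendsto (fun t => t ^ β * k₁ t) atTop (𝓝 b))
    (hf : ContinuousOn (fun q : ℝ × ℝ => f q.1 q.2) (Ioi 0 ×ˢ univ))
    (hfb : ∀ t x : ℝ, 0 < t → l₁ t * P x + k₁ t ≤ f t x ∧ f t x ≤ l t * P x + k t) (x₀ : ℝ) :
    ∃ x : ℝ → ℝ, MemCWeighted (1 - β) x ∧ IsRLSolution β f x₀ x ∧
      Tendsto x atTop (𝓝 (b * π / (Real.Gamma β * Real.sin (β * π)))) := by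
  have hp1 : 1 < p := (one_lt_one_div hβ hβ1).trans hp
  obtain ⟨a, hpa, haβ⟩ := exists_between ((one_div_lt hβ (zero_lt_one.trans hp1)).1 hp)
  have ha : 0 < a := (one_div_pos.2 (zero_lt_one.trans hp1)).trans hpa
  have hweight := fun {h : ℝ → ℝ} => isAbelWeight_of_memLp (h := h) haβ.le hβ1.le hp1 hpa
  obtain ⟨x, hx⟩ := exists_isVolterraSolution ha haβ hβ1
    (weightedAffineGrowth_of_sandwich hμ₀ hμ₁ hP hf hfb)
    (((hweight hl).add (hweight hl₁)).add ((hweight hk).add (hweight hk₁))) x₀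
  have hP1 : ∀ z, |P z| ≤ 1 + |z| := fun z =>
    (hP z).trans (rpow_le_one_add hμ₀ hμ₁ (abs_nonneg z))
  have hΓ : 0 < Real.Gamma (1 - β) := Real.Gamma_pos_of_pos (sub_pos.2 hβ1)
  obtain ⟨η, hη, hηΓ⟩ := exists_between (one_div_pos.2 hΓ)
  obtain ⟨C, hC⟩ := exists_eventually_abs_le_of_sandwich hP1 hl0 hl₁0 hkb hk₁b hfb hη
  have hbdd := hx.exists_bound hβ hβ1 hη.le ((lt_div_iff₀ hΓ).1 hηΓ) (hC.mono fun s hs => hs (x s))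
  refine ⟨x, ⟨hx.continuousOn, x₀, hx.initial⟩, hx.isRLSolution hβ hβ1 hf, ?_⟩
  rw [← mul_Gamma_one_sub hβ]
  exact hx.tendsto hβ hβ1 (tendsto_of_sandwich hP1 hl0 hl₁0 hkb hk₁b hfb hbdd)

theorem theorem3p7 (β γ μ p K b : ℝ) (hβ : 0 < β) (hβγ : β < γ) (hγ : γ < 1)
    (hμ₀ : 0 ≤ μ) (hμ₁ : μ ≤ 1) (hp : 1 / β < p) (hK : 0 ≤ K)
    (P : ℝ → ℝ) (hP : IsRealPower μ P)
    (l l₁ k k₁ : ℝ → ℝ) (f : ℝ → ℝ → ℝ)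
    (hl : MemCLpLoc p (fun t => t ^ ((1 - μ) * (1 - β)) * l t))
    (hl₁ : MemCLpLoc p (fun t => t ^ ((1 - μ) * (1 - β)) * l₁ t))
    (hlK : ∀ t : ℝ, 1 ≤ t → t ^ γ * |l t| ≤ K)
    (hl₁K : ∀ t : ℝ, 1 ≤ t → t ^ γ * |l₁ t| ≤ K)
    (hk : MemCLpLoc p (fun t => t ^ (1 - β) * k t))
    (hk₁ : MemCLpLoc p (fun t => t ^ (1 - β) * k₁ t))
    (hkb : Tendsto (fun t => t ^ β * k t) atTop (𝓝 b))
    (hk₁b : Tendsto (fun t => t ^ β * k₁ t) atTop (𝓝 b))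
    (hf : ContinuousOn (fun q : ℝ × ℝ => f q.1 q.2) (Ioi 0 ×ˢ univ))
    (hfb : ∀ t x : ℝ, 0 < t →
      l₁ t * P x + k₁ t ≤ f t x ∧ f t x ≤ l t * P x + k t)
    (x₀ : ℝ) :
    ∃ x : ℝ → ℝ, MemCWeighted (1 - β) x ∧ IsRLSolution β f x₀ x ∧
      Tendsto x atTop (𝓝 (b * π / (Real.Gamma β * Real.sin (β * π)))) :=
  theorem3p7_general hβ (hβγ.trans hγ) hμ₀ hμ₁ hp (fun x => (hP.abs_eq x).le) hl.2 hl₁.2 hk.2 hk₁.2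
    (tendsto_rpow_mul_of_rpow_mul_abs_le hβγ hlK) (tendsto_rpow_mul_of_rpow_mul_abs_le hβγ hl₁K)
    hkb hk₁b hf hfb x₀
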